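/- **Conventions.** A *functorial factorisation* on a category $\mathbb{C}$ assigns to each $f\colon X\to Y$ a factorisation $X\xrightarrow{Lf}Kf\xrightarrow{Rf}Y$, functorially in commutative squares; then $L$ is a copointed and $R$ a pointed endofunctor of $\mathbb{C}^{\mathbf 2}$. A *lawfs* $(L,R)$ is a functorial factorisation with a comultiplication making the copointed endofunctor $L$ a comonad. An *awfs* is a lawfs with, in addition, a multiplication making the pointed endofunctor $R$ a monad, such that the canonical natural transformation $LR\Rightarrow RL$ is a distributive law. Morphisms of lawfs's (awfs's) are morphisms of functorial factorisations that induce comonad morphisms (and monad morphisms). Write $R\text{-}\mathbf{Map}$ for the category of algebras for the monad $R$, and $L\text{-}\mathbf{map}$ for the category of coalgebras for the copointed endofunctor underlying $L$. An awfs $(L,R)$ is *pullback stable* if $R$ sends pullback squares to pullback squares. A morphism of lawfs's $\zeta\colon(L_1,R_1)\to(L,R)$ to (the underlying lawfs of) an awfs *witnesses that $(L,R)$ is algebraically free on $(L_1,R_1)$* if the induced functor from algebras for the monad $R$ to algebras for the pointed endofunctor $R_1$ is an isomorphism of categories. A *pre-ams* consists of awfs's $(C^t,F)$ and $(C,F^t)$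 and a morphism of awfs's $\xi\colon(C^t,F)\to(C,F^t)$. **Setting.** Let $\mathbb{C}$ be a finitely complete and finitely cocomplete category with a symmetric monoidal product $\otimes$ whose unit $1$ is terminal and which preserves finite colimits in each variable. Let $\delta_0,\delta_1\colon 1\to\mathbb{I}$ be an interval object such that $-\otimes\mathbb{I}$ has a right adjoint $P$. Let $\hat\otimes$ denote pushout product, and for $j\in\{\delta_0,\delta_1,[\delta_0,\delta_1]\colon 1+1\to\mathbb{I}\}$, $j\colon U\to\mathbb{I}$, and $f\colon X\to Y$, let $\widehat{\hom}(j,f)\colon PX\to\hom(U,X)\times_{\hom(U,Y)}PY$ be the pullback hom, where $\hom(1,X)=X$ and $\hom(1+1,X)=X\times X$. Let $\xi\colon(C^t,F)\to(C,F^t)$ be a pre-ams on $\mathbb{C}$ such that $(C,F^t)$ is pullback stable and 1. $m\mapsto m\,\hat\otimes\,[\delta_0,\delta_1]$ lifts to a functor $C\text{-}\mathbf{map}\to C\text{-}\mathbf{map}$; 2. for $i=0,1$, $f\mapsto\widehat{\hom}(\delta_i,f)$ lifts to a functor $F\text{-}\mathbf{Map}\to F^t\text{-}\mathbf{Map}$;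 3. $f\mapsto\widehat{\hom}([\delta_0,\delta_1],f)$ lifts to a functor $F\text{-}\mathbf{Map}\to F\text{-}\mathbf{Map}$. Suppose that $(C_1,F^t_1)$ is a lawfs, that $\zeta\colon(C_1,F^t_1)\to(C,F^t)$ is a morphism of lawfs's witnessing that $(C,F^t)$ is algebraically free on $(C_1,F^t_1)$, and that $\mu\colon (F^t_1)^2\to F^t_1$ is a multiplication making the pointed endofunctor $F^t_1$ a monad (no distributive law is required). For $f\colon X\to Y$ let $P_Y(X)=Y\times_{PY}PX$ be the mapping path space, the pullback of $Pf$ along the map $Y\to PY$ of constant paths (the transpose of the projection $Y\otimes\mathbb{I}\to Y$). Let $r\colon X\to P_Y(X)$ be the map given by $f$ and the constant paths $X\to PX$, and let $\langle p_0,p_1\rangle\colon P_Y(X)\to X\times_Y X$ be given by evaluating the path at $\delta_0$ and $\delta_1$, so that $\langle p_0,p_1\rangle\circ r$ is the diagonal. Define $\mathrm{Id}_Y(X)$ by the $(C_1,F^t_1)$-factorisation $$X\xrightarrow{\;C_1r\;}\mathrm{Id}_Y(X)\xrightarrow{\;F^t_1r\;}P_Y(X)$$ of $r$. **Theorem.**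 The factorisation $$X\xrightarrow{\;C_1r\;}\mathrm{Id}_Y(X)\xrightarrow{\;\langle p_0,p_1\rangle\circ F^t_1r\;}X\times_YX$$ of the diagonal, for $f\colon X\to Y$ ranging over $F\text{-}\mathbf{Map}$, can be equipped with the structure of a functorial choice of very good path objects for $(C^t,F)$. That is, the maps $C_1r$ can be given $C^t$-coalgebra structures (for the copointed endofunctor) and the maps $\langle p_0,p_1\rangle\circ F^t_1r$ can be given $F$-algebra structures (for the monad), functorially in $f\in F\text{-}\mathbf{Map}$; equivalently, this assignment of factorisations is the action on objects of a functor $F\text{-}\mathbf{Map}\to F\text{-}\mathbf{Map}\times_{\mathbb{C}}C^t\text{-}\mathbf{map}$ acting on a morphism of $F\text{-}\mathbf{Map}$ with underlying square $(h,k)\colon f\to f'$ by $h$, the induced map $\mathrm{Id}_Y(X)\to\mathrm{Id}_{Y'}(X')$ and the induced map $X\times_YX\to X'\times_{Y'}X'$. -/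

import Mathlib

open CategoryTheory CategoryTheory.Limits CategoryTheory.MonoidalCategory

universe v u w z

namespace AlgFact

/-! ### Algebras and coalgebras for (co)pointed endofunctors -/

section PointedEndofunctors

variable {A : Type u} [Category.{v} A]

/-- A coalgebra for the copointed endofunctor `(G, ε)`. -/
structure CopointedCoalgebra {G : A ⥤ A} (ε : G ⟶ 𝟭 A) where
  /-- the underlying object -/
  X : A
  /-- the structure map -/
  a : X ⟶ G.obj X
  counit : a ≫ ε.app X = 𝟙 X

namespace CopointedCoalgebra

variable {G : A ⥤ A} {ε : G ⟶ 𝟭 A}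

/-- A morphism of coalgebras for a copointed endofunctor. -/
@[ext]
structure Hom (M N : CopointedCoalgebra ε) where
  /-- the underlying morphism -/
  f : M.X ⟶ N.X
  comm : f ≫ N.a = M.a ≫ G.map f

instance : Category (CopointedCoalgebra ε) where
  Hom M N := Hom M N
  id M := { f := 𝟙 _, comm := by simp }
  comp {M N K} g h :=
    { f := g.f ≫ h.f
      comm := by rw [Category.assoc, h.comm, ← Category.assoc, g.comm]; simp }
  id_comp _ := Hom.ext (Category.id_comp _)
  comp_id _ := Hom.ext (Category.comp_id _)
  assoc _ _ _ := Hom.ext (Category.assoc _ _ _)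

/-- The forgetful functor. -/
@[simps]
abbrev forget (ε : G ⟶ 𝟭 A) : CopointedCoalgebra ε ⥤ A where
  obj M := M.X
  map g := g.f

end CopointedCoalgebra

/-- An algebra for the pointed endofunctor `(T, η)`. -/
structure PointedAlgebra {T : A ⥤ A} (η : 𝟭 A ⟶ T) where
  /-- the underlying object -/
  X : A
  /-- the structure map -/
  a : T.obj X ⟶ X
  unit : η.app X ≫ a = 𝟙 X

namespace PointedAlgebra

variable {T : A ⥤ A} {η : 𝟭 A ⟶ T}

/-- A morphism of algebras for a pointed endofunctor. -/
@[ext]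
structure Hom (M N : PointedAlgebra η) where
  /-- the underlying morphism -/
  f : M.X ⟶ N.X
  comm : T.map f ≫ N.a = M.a ≫ f

instance : Category (PointedAlgebra η) where
  Hom M N := Hom M N
  id M := { f := 𝟙 _, comm := by simp }
  comp {M N K} g h :=
    { f := g.f ≫ h.f
      comm := by rw [T.map_comp, Category.assoc, h.comm, ← Category.assoc, g.comm]; simp }
  id_comp _ := Hom.ext (Category.id_comp _)
  comp_id _ := Hom.ext (Category.comp_id _)
  assoc _ _ _ := Hom.ext (Category.assoc _ _ _)

end PointedAlgebra

/-- A functorial choice of `T`-algebra structures on the objects `G.obj x`; equivalently, a functor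
`B ⥤ T.Algebra` whose composite with the forgetful functor is (strictly) `G`. -/
structure FunctorialAlgebraStructure {B : Type w} [Category.{z} B] (T : Monad A)
    (G : B ⥤ A) where
  /-- the structure maps -/
  act : ∀ x : B, T.obj (G.obj x) ⟶ G.obj x
  unit : ∀ x : B, T.η.app (G.obj x) ≫ act x = 𝟙 (G.obj x)
  assoc : ∀ x : B, T.μ.app (G.obj x) ≫ act x = T.map (act x) ≫ act x
  natural : ∀ {x y : B} (φ : x ⟶ y), T.map (G.map φ) ≫ act y = act x ≫ G.map φ

/-- The functor to algebras given by a functorial choice of algebra structures. -/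
def FunctorialAlgebraStructure.functor {B : Type w} [Category.{z} B] {T : Monad A}
    {G : B ⥤ A} (S : FunctorialAlgebraStructure T G) : B ⥤ T.Algebra where
  obj x := { A := G.obj x, a := S.act x, unit := S.unit x, assoc := S.assoc x }
  map φ := { f := G.map φ, h := S.natural φ }

theorem FunctorialAlgebraStructure.functor_forget {B : Type w} [Category.{z} B] {T : Monad A}
    {G : B ⥤ A} (S : FunctorialAlgebraStructure T G) : S.functor ⋙ T.forget = G := rfl

/-- A functorial choice of structures of coalgebra for the copointed endofunctor `(H, ε)` on the
objects `G.obj x`; equivalently, a functor `B ⥤ CopointedCoalgebra ε` whose composite with the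
forgetful functor is (strictly) `G`. -/
structure FunctorialCoalgebraStructure {B : Type w} [Category.{z} B] {H : A ⥤ A}
    (ε : H ⟶ 𝟭 A) (G : B ⥤ A) where
  /-- the structure maps -/
  coact : ∀ x : B, G.obj x ⟶ H.obj (G.obj x)
  counit : ∀ x : B, coact x ≫ ε.app (G.obj x) = 𝟙 (G.obj x)
  natural : ∀ {x y : B} (φ : x ⟶ y), G.map φ ≫ coact y = coact x ≫ H.map (G.map φ)

/-- The functor to coalgebras given by a functorial choice of coalgebra structures. -/
def FunctorialCoalgebraStructure.functor {B : Type w} [Category.{z} B] {H : A ⥤ A}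
    {ε : H ⟶ 𝟭 A} {G : B ⥤ A} (S : FunctorialCoalgebraStructure ε G) :
    B ⥤ CopointedCoalgebra ε where
  obj x := { X := G.obj x, a := S.coact x, counit := S.counit x }
  map φ := { f := G.map φ, comm := S.natural φ }
  map_id x := CopointedCoalgebra.Hom.ext (G.map_id x)
  map_comp φ ψ := CopointedCoalgebra.Hom.ext (G.map_comp φ ψ)

theorem FunctorialCoalgebraStructure.functor_forget {B : Type w} [Category.{z} B] {H : A ⥤ A}
    {ε : H ⟶ 𝟭 A} {G : B ⥤ A} (S : FunctorialCoalgebraStructure ε G) :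
    S.functor ⋙ CopointedCoalgebra.forget ε = G := rfl

/-- `Δ : G T ⟶ T G` is a (mixed) distributive law between the comonad `G` and the monad `T`. -/
structure IsDistributiveLaw (G : Comonad A) (T : Monad A)
    (Δ : ∀ X : A, G.obj (T.obj X) ⟶ T.obj (G.obj X)) : Prop where
  natural : ∀ {X Y : A} (f : X ⟶ Y), G.map (T.map f) ≫ Δ Y = Δ X ≫ T.map (G.map f)
  unit : ∀ X : A, G.map (T.η.app X) ≫ Δ X = T.η.app (G.obj X)
  mul : ∀ X : A, G.map (T.μ.app X) ≫ Δ X = Δ (T.obj X) ≫ T.map (Δ X) ≫ T.μ.app (G.obj X)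
  counit : ∀ X : A, Δ X ≫ T.map (G.ε.app X) = G.ε.app (T.obj X)
  comul : ∀ X : A, Δ X ≫ T.map (G.δ.app X) = G.δ.app (T.obj X) ≫ G.map (Δ X) ≫ Δ (G.obj X)

/-- A functor is an isomorphism of categories if it has a strict inverse. -/
def IsCategoryIso {B : Type w} [Category.{z} B] (F : A ⥤ B) : Prop :=
  ∃ G : B ⥤ A, F ⋙ G = 𝟭 A ∧ G ⋙ F = 𝟭 B

end PointedEndofunctors

/-! ### Functorial factorisations and algebraic weak factorisation systems -/

section Factorisations

/-- A functorial factorisation: every `f : X ⟶ Y` is factored as `L f : X ⟶ K f` followed by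
`R f : K f ⟶ Y`, functorially in commutative squares. -/
structure FunctorialFactorisation (C : Type u) [Category.{v} C] where
  /-- the middle object -/
  K : Arrow C ⥤ C
  /-- the left part -/
  L : ∀ f : Arrow C, f.left ⟶ K.obj f
  /-- the right part -/
  R : ∀ f : Arrow C, K.obj f ⟶ f.right
  fac : ∀ f : Arrow C, L f ≫ R f = f.hom
  L_natural : ∀ {f g : Arrow C} (φ : f ⟶ g), φ.left ≫ L g = L f ≫ K.map φ
  R_natural : ∀ {f g : Arrow C} (φ : f ⟶ g), K.map φ ≫ R g = R f ≫ φ.right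

variable {C : Type u} [Category.{v} C]

namespace FunctorialFactorisation

variable (Φ : FunctorialFactorisation C)

/-- The endofunctor `L` of the arrow category. -/
@[simps]
abbrev left : Arrow C ⥤ Arrow C where
  obj f := Arrow.mk (Φ.L f)
  map φ := Arrow.homMk φ.left (Φ.K.map φ) (Φ.L_natural φ)

/-- The endofunctor `R` of the arrow category. -/
@[simps]
abbrev right : Arrow C ⥤ Arrow C where
  obj f := Arrow.mk (Φ.R f)
  map φ := Arrow.homMk (Φ.K.map φ) φ.right (Φ.R_natural φ)

/-- The canonical copoint `L ⟶ 𝟭`. -/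
@[simps]
abbrev counit : Φ.left ⟶ 𝟭 (Arrow C) where
  app f := Arrow.homMk (𝟙 f.left) (Φ.R f) ((Category.id_comp f.hom).trans (Φ.fac f).symm)
  naturality f g φ := by
    apply Arrow.hom_ext
    · exact (Category.comp_id _).trans (Category.id_comp _).symm
    · exact Φ.R_natural φ

/-- The canonical point `𝟭 ⟶ R`. -/
@[simps]
abbrev unit : 𝟭 (Arrow C) ⟶ Φ.right where
  app f := Arrow.homMk (Φ.L f) (𝟙 f.right) ((Φ.fac f).trans (Category.comp_id f.hom).symm)
  naturality f g φ := by
    apply Arrow.hom_ext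
    · exact Φ.L_natural φ
    · exact (Category.comp_id _).trans (Category.id_comp _).symm

/-- A comultiplication making the copointed endofunctor `L` a comonad. -/
structure Comultiplication where
  /-- the comultiplication -/
  δ : Φ.left ⟶ Φ.left ⋙ Φ.left
  coassoc : ∀ f, δ.app f ≫ Φ.left.map (δ.app f) = δ.app f ≫ δ.app (Φ.left.obj f)
  left_counit : ∀ f, δ.app f ≫ Φ.counit.app (Φ.left.obj f) = 𝟙 (Φ.left.obj f)
  right_counit : ∀ f, δ.app f ≫ Φ.left.map (Φ.counit.app f) = 𝟙 (Φ.left.obj f)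

/-- A multiplication making the pointed endofunctor `R` a monad. -/
structure Multiplication where
  /-- the multiplication -/
  μ : Φ.right ⋙ Φ.right ⟶ Φ.right
  assoc : ∀ f, Φ.right.map (μ.app f) ≫ μ.app f = μ.app (Φ.right.obj f) ≫ μ.app f
  left_unit : ∀ f, Φ.unit.app (Φ.right.obj f) ≫ μ.app f = 𝟙 (Φ.right.obj f)
  right_unit : ∀ f, Φ.right.map (Φ.unit.app f) ≫ μ.app f = 𝟙 (Φ.right.obj f)

variable {Φ}

/-- The comonad structure on `L`. -/
abbrev Comultiplication.comonad (c : Φ.Comultiplication) : Comonad (Arrow C) where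
  toFunctor := Φ.left
  ε := Φ.counit
  δ := c.δ
  coassoc := c.coassoc
  left_counit := c.left_counit
  right_counit := c.right_counit

/-- The monad structure on `R`. -/
abbrev Multiplication.monad (m : Φ.Multiplication) : Monad (Arrow C) where
  toFunctor := Φ.right
  η := Φ.unit
  μ := m.μ
  assoc := m.assoc
  left_unit := m.left_unit
  right_unit := m.right_unit

/-- The canonical map `L R ⟶ R L`. At `f` it is the square from `L (R f)` to `R (L f)` whose
horizontal sides are the codomain part `K f ⟶ K (L f)` of the comultiplication and the domain part
`K (R f) ⟶ K f` of the multiplication. -/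
def exchange (c : Φ.Comultiplication) (m : Φ.Multiplication) (f : Arrow C) :
    Φ.left.obj (Φ.right.obj f) ⟶ Φ.right.obj (Φ.left.obj f) :=
  Arrow.homMk (c.δ.app f).right (m.μ.app f).left
    ((congrArg (fun s => s.right) (c.left_counit f)).trans
      (congrArg (fun s => s.left) (m.left_unit f)).symm)

variable (Φ)

/-- A morphism of functorial factorisations. -/
structure Hom (Ψ : FunctorialFactorisation C) where
  /-- the comparison between the middle objects -/
  app : ∀ f : Arrow C, Φ.K.obj f ⟶ Ψ.K.obj f
  natural : ∀ {f g : Arrow C} (φ : f ⟶ g), Φ.K.map φ ≫ app g = app f ≫ Ψ.K.map φ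
  L_app : ∀ f : Arrow C, Φ.L f ≫ app f = Ψ.L f
  app_R : ∀ f : Arrow C, app f ≫ Ψ.R f = Φ.R f

variable {Φ} {Ψ : FunctorialFactorisation C}

/-- The square `L f ⟶ L' f` induced by a morphism of functorial factorisations. -/
@[simps!]
abbrev Hom.leftApp (ζ : Φ.Hom Ψ) (f : Arrow C) : Φ.left.obj f ⟶ Ψ.left.obj f :=
  Arrow.homMk (𝟙 f.left) (ζ.app f) ((Category.id_comp (Ψ.L f)).trans (ζ.L_app f).symm)

/-- The square `R f ⟶ R' f` induced by a morphism of functorial factorisations. -/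
@[simps!]
abbrev Hom.rightApp (ζ : Φ.Hom Ψ) (f : Arrow C) : Φ.right.obj f ⟶ Ψ.right.obj f :=
  Arrow.homMk (ζ.app f) (𝟙 f.right) ((ζ.app_R f).trans (Category.comp_id (Φ.R f)).symm)

/-- The functor from algebras for the monad `R'` to algebras for the pointed endofunctor `R`
induced by a morphism of functorial factorisations `(L, R) ⟶ (L', R')`. -/
def Hom.algebraFunctor (ζ : Φ.Hom Ψ) (m : Ψ.Multiplication) :
    m.monad.Algebra ⥤ PointedAlgebra Φ.unit where
  obj M :=
    { X := M.A
      a := ζ.rightApp M.A ≫ M.a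
      unit := by
        have h : Φ.unit.app M.A ≫ ζ.rightApp M.A = Ψ.unit.app M.A := by
          apply Arrow.hom_ext
          · exact ζ.L_app M.A
          · exact Category.comp_id _
        exact ((Category.assoc _ _ _).symm.trans (congrArg (fun s => s ≫ M.a) h)).trans M.unit }
  map {M N} g :=
    { f := g.f
      comm := by
        have h : Φ.right.map g.f ≫ ζ.rightApp N.A = ζ.rightApp M.A ≫ Ψ.right.map g.f := by
          apply Arrow.hom_ext
          · exact ζ.natural g.f
          · exact (Category.comp_id _).trans (Category.id_comp _).symm
        have h' : Ψ.right.map g.f ≫ N.a = M.a ≫ g.f := g.h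
        exact (((Category.assoc _ _ _).symm.trans (congrArg (fun s => s ≫ N.a) h)).trans
          (Category.assoc _ _ _)).trans
            ((congrArg (fun s => ζ.rightApp M.A ≫ s) h').trans (Category.assoc _ _ _).symm) }
  map_id _ := rfl
  map_comp _ _ := rfl

end FunctorialFactorisation

/-- A left algebraic weak factorisation system (lawfs): a functorial factorisation together with a
comultiplication making its left part a comonad. -/
structure LAWFS (C : Type u) [Category.{v} C] extends FunctorialFactorisation C where
  /-- the comultiplication -/
  comul : toFunctorialFactorisation.Comultiplication

/-- An algebraic weak factorisation system (awfs). -/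
structure AWFS (C : Type u) [Category.{v} C] extends LAWFS C where
  /-- the multiplication -/
  mul : toFunctorialFactorisation.Multiplication
  distributive : IsDistributiveLaw comul.comonad mul.monad
    (FunctorialFactorisation.exchange comul mul)

/-- A morphism of lawfs's: a morphism of functorial factorisations which induces a morphism of
comonads. -/
structure LAWFS.Hom (Φ Ψ : LAWFS C) extends
    FunctorialFactorisation.Hom Φ.toFunctorialFactorisation Ψ.toFunctorialFactorisation where
  comul : ∀ f : Arrow C, toHom.leftApp f ≫ Ψ.comul.δ.app f =
    Φ.comul.δ.app f ≫ toHom.leftApp (Φ.left.obj f) ≫ Ψ.left.map (toHom.leftApp f)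

/-- A morphism of awfs's: a morphism of functorial factorisations which induces a morphism of
comonads and a morphism of monads. -/
structure AWFS.Hom (Φ Ψ : AWFS C) extends toLAWFSHom : LAWFS.Hom Φ.toLAWFS Ψ.toLAWFS where
  mul : ∀ f : Arrow C, Φ.mul.μ.app f ≫ toHom.rightApp f =
    (Φ.right.map (toHom.rightApp f) ≫ toHom.rightApp (Ψ.right.obj f)) ≫ Ψ.mul.μ.app f

/-- The awfs `Ψ = (L', R')` is algebraically free on the lawfs `Φ = (L, R)`, as witnessed by the
morphism of lawfs's `ζ`: the induced functor from algebras for the monad `R'` to algebras for the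
pointed endofunctor `R` is an isomorphism of categories. -/
def LAWFS.Hom.IsAlgebraicallyFree {Φ : LAWFS C} {Ψ : AWFS C} (ζ : Φ.Hom Ψ.toLAWFS) : Prop :=
  IsCategoryIso (ζ.toHom.algebraFunctor Ψ.mul)

namespace AWFS

variable (Φ : AWFS C)

/-- The category of maps equipped with an algebra structure for the monad `R`. -/
abbrev RightMap := Φ.mul.monad.Algebra

/-- The category of maps equipped with a coalgebra structure for the underlying copointed
endofunctor of `L`. -/
abbrev LeftMap := CopointedCoalgebra Φ.counit

/-- The awfs is pullback stable if its right part sends pullback squares to pullback squares. -/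
def PullbackStable : Prop :=
  ∀ ⦃f g : Arrow C⦄ (φ : f ⟶ g), IsPullback φ.left f.hom g.hom φ.right →
    IsPullback (Φ.K.map φ) (Φ.R f) (Φ.R g) φ.right

end AWFS

/-- A pre algebraic model structure: awfs's `(Cᵗ, F)` (called `trivCof`) and `(C, Fᵗ)` (called
`cof`), together with a morphism of awfs's from the first to the second, the comparison map. -/
structure PreAMS (C : Type u) [Category.{v} C] where
  /-- the awfs `(Cᵗ, F)` -/
  trivCof : AWFS C
  /-- the awfs `(C, Fᵗ)` -/
  cof : AWFS C
  /-- the comparison map -/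
  comparison : trivCof.Hom cof

end Factorisations

noncomputable section

/-! ### Functorial choices of very good path objects -/

section PathObjects

variable {C : Type u} [Category.{v} C] [HasPullbacks C]

/-- The functor sending `f : X ⟶ Y` to `X ×_Y X`. -/
@[simps]
abbrev fibreSquare : Arrow C ⥤ C where
  obj f := pullback f.hom f.hom
  map {f g} φ := pullback.lift (pullback.fst f.hom f.hom ≫ φ.left)
    (pullback.snd f.hom f.hom ≫ φ.left)
    (by rw [Category.assoc, Category.assoc, Arrow.w, pullback.condition_assoc])
  map_id f := by apply pullback.hom_ext <;> simp
  map_comp φ ψ := by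
    apply pullback.hom_ext
    · simp [pullback.lift_fst, pullback.lift_fst_assoc]
    · simp [pullback.lift_snd, pullback.lift_snd_assoc]

/-- A choice, functorial in the right maps `f : X ⟶ Y` of an awfs, of a factorisation of the
diagonal `X ⟶ X ×_Y X`. -/
structure DiagonalFactorisation (Φ : AWFS C) where
  /-- the middle object -/
  P : Φ.RightMap ⥤ C
  /-- the first map of the factorisation -/
  r : ∀ f : Φ.RightMap, f.A.left ⟶ P.obj f
  /-- the second map of the factorisation -/
  p : ∀ f : Φ.RightMap, P.obj f ⟶ fibreSquare.obj f.A
  fac : ∀ f : Φ.RightMap, r f ≫ p f = pullback.diagonal f.A.hom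
  r_natural : ∀ {f g : Φ.RightMap} (φ : f ⟶ g), φ.f.left ≫ r g = r f ≫ P.map φ
  p_natural : ∀ {f g : Φ.RightMap} (φ : f ⟶ g), P.map φ ≫ p g = p f ≫ fibreSquare.map φ.f

namespace DiagonalFactorisation

variable {Φ : AWFS C} (D : DiagonalFactorisation Φ)

/-- The functor `f ↦ (r f : X ⟶ P f)`. -/
@[simps]
abbrev rFunctor : Φ.RightMap ⥤ Arrow C where
  obj f := Arrow.mk (D.r f)
  map φ := Arrow.homMk φ.f.left (D.P.map φ) (D.r_natural φ)

/-- The functor `f ↦ (p f : P f ⟶ X ×_Y X)`. -/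
@[simps]
abbrev pFunctor : Φ.RightMap ⥤ Arrow C where
  obj f := Arrow.mk (D.p f)
  map φ := Arrow.homMk (D.P.map φ) (fibreSquare.map φ.f) (D.p_natural φ)
  map_id f := by
    apply Arrow.hom_ext
    · exact D.P.map_id f
    · exact fibreSquare.map_id f.A
  map_comp φ ψ := by
    apply Arrow.hom_ext
    · exact D.P.map_comp φ ψ
    · exact fibreSquare.map_comp φ.f ψ.f

end DiagonalFactorisation

/-- A functorial choice of very good path objects for an awfs `(Cᵗ, F)`: a functorial choice of
factorisations `X ⟶ P f ⟶ X ×_Y X` of the diagonals of the `F`-algebras `f : X ⟶ Y`, with a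
functorial choice of structures of coalgebra for the copointed endofunctor `Cᵗ` on the maps
`X ⟶ P f` and of `F`-algebra structures on the maps `P f ⟶ X ×_Y X`. -/
structure FunctorialVeryGoodPathObjects (Φ : AWFS C) extends DiagonalFactorisation Φ where
  /-- the coalgebra structures on the maps `X ⟶ P f` -/
  rStructure : FunctorialCoalgebraStructure Φ.counit toDiagonalFactorisation.rFunctor
  /-- the algebra structures on the maps `P f ⟶ X ×_Y X` -/
  pStructure : FunctorialAlgebraStructure Φ.mul.monad toDiagonalFactorisation.pFunctor

end PathObjects

/-! ### The Leibniz constructions for the interval -/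

section Interval

variable (C : Type u) [Category.{v} C] [SemiCartesianMonoidalCategory C]

/-- An interval object `δ₀, δ₁ : 1 ⟶ I` (the unit `1` of the affine monoidal product is terminal)
together with a right adjoint `P` of `- ⊗ I`. -/
structure Interval where
  /-- the interval -/
  I : C
  /-- the first endpoint -/
  δ₀ : 𝟙_ C ⟶ I
  /-- the second endpoint -/
  δ₁ : 𝟙_ C ⟶ I
  /-- the path functor -/
  P : C ⥤ C
  /-- the adjunction between `- ⊗ I` and the path functor -/
  adj : tensorRight I ⊣ P

variable {C}

/-- The functor `X ↦ X × X`. -/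
@[simps]
abbrev square [HasBinaryProducts C] : C ⥤ C where
  obj X := X ⨯ X
  map f := prod.map f f

/-- The identity functor is right adjoint to `- ⊗ 1`. -/
def unitAdj : tensorRight (𝟙_ C) ⊣ 𝟭 C :=
  Adjunction.id.ofNatIsoLeft (rightUnitorNatIso C).symm

/-- The colimit cocone exhibiting `X ⊗ (1 + 1)` as a coproduct of two copies of `X ⊗ 1`. -/
def tensorTwoIsColimit [HasBinaryCoproducts C] (X : C) [PreservesFiniteColimits (tensorLeft X)] :
    IsColimit (BinaryCofan.mk (X ◁ (coprod.inl : 𝟙_ C ⟶ 𝟙_ C ⨿ 𝟙_ C))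
      (X ◁ (coprod.inr : 𝟙_ C ⟶ 𝟙_ C ⨿ 𝟙_ C))) :=
  isColimitOfHasBinaryCoproductOfPreservesColimit (tensorLeft X) (𝟙_ C) (𝟙_ C)

/-- The map `X ⊗ (1 + 1) ⟶ Y` corresponding to a map `X ⟶ Y × Y`. -/
def twoDesc [HasBinaryProducts C] [HasBinaryCoproducts C] {X Y : C}
    [PreservesFiniteColimits (tensorLeft X)] (g : X ⟶ Y ⨯ Y) : X ⊗ (𝟙_ C ⨿ 𝟙_ C) ⟶ Y :=
  BinaryCofan.IsColimit.desc (tensorTwoIsColimit X)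
    ((ρ_ X).hom ≫ g ≫ prod.fst) ((ρ_ X).hom ≫ g ≫ prod.snd)

theorem inl_twoDesc [HasBinaryProducts C] [HasBinaryCoproducts C] {X Y : C}
    [PreservesFiniteColimits (tensorLeft X)] (g : X ⟶ Y ⨯ Y) :
    X ◁ (coprod.inl : 𝟙_ C ⟶ 𝟙_ C ⨿ 𝟙_ C) ≫ twoDesc g = (ρ_ X).hom ≫ g ≫ prod.fst :=
  BinaryCofan.IsColimit.inl_desc (tensorTwoIsColimit X) _ _

theorem inr_twoDesc [HasBinaryProducts C] [HasBinaryCoproducts C] {X Y : C}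
    [PreservesFiniteColimits (tensorLeft X)] (g : X ⟶ Y ⨯ Y) :
    X ◁ (coprod.inr : 𝟙_ C ⟶ 𝟙_ C ⨿ 𝟙_ C) ≫ twoDesc g = (ρ_ X).hom ≫ g ≫ prod.snd :=
  BinaryCofan.IsColimit.inr_desc (tensorTwoIsColimit X) _ _

theorem tensorTwo_hom_ext [HasBinaryCoproducts C] {X Y : C}
    [PreservesFiniteColimits (tensorLeft X)] {f g : X ⊗ (𝟙_ C ⨿ 𝟙_ C) ⟶ Y}
    (h₁ : X ◁ (coprod.inl : 𝟙_ C ⟶ 𝟙_ C ⨿ 𝟙_ C) ≫ f = X ◁ coprod.inl ≫ g)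
    (h₂ : X ◁ (coprod.inr : 𝟙_ C ⟶ 𝟙_ C ⨿ 𝟙_ C) ≫ f = X ◁ coprod.inr ≫ g) : f = g :=
  BinaryCofan.IsColimit.hom_ext (tensorTwoIsColimit X) h₁ h₂

/-- The map `X ⟶ Y × Y` corresponding to a map `X ⊗ (1 + 1) ⟶ Y`. -/
def twoLift [HasBinaryProducts C] [HasBinaryCoproducts C] {X Y : C}
    (f : X ⊗ (𝟙_ C ⨿ 𝟙_ C) ⟶ Y) : X ⟶ Y ⨯ Y :=
  prod.lift ((ρ_ X).inv ≫ X ◁ coprod.inl ≫ f) ((ρ_ X).inv ≫ X ◁ coprod.inr ≫ f)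

/-- Maps out of `X ⊗ (1 + 1) ≅ X + X` are maps into `Y × Y`. -/
@[simps]
def twoEquiv [HasBinaryProducts C] [HasBinaryCoproducts C] (X Y : C)
    [PreservesFiniteColimits (tensorLeft X)] : (X ⊗ (𝟙_ C ⨿ 𝟙_ C) ⟶ Y) ≃ (X ⟶ Y ⨯ Y) where
  toFun f := twoLift f
  invFun g := twoDesc g
  left_inv f := by
    apply tensorTwo_hom_ext
    · rw [inl_twoDesc]; simp [twoLift, prod.lift_fst]
    · rw [inr_twoDesc]; simp [twoLift, prod.lift_snd]
  right_inv g := by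
    apply Limits.prod.hom_ext
    · simp [twoLift, inl_twoDesc, prod.lift_fst]
    · simp [twoLift, inr_twoDesc, prod.lift_snd]

theorem twoDesc_comp [HasBinaryProducts C] [HasBinaryCoproducts C] {X' X Y : C}
    [PreservesFiniteColimits (tensorLeft X)] [PreservesFiniteColimits (tensorLeft X')]
    (f : X' ⟶ X) (g : X ⟶ Y ⨯ Y) : twoDesc (f ≫ g) = f ▷ (𝟙_ C ⨿ 𝟙_ C) ≫ twoDesc g := by
  apply tensorTwo_hom_ext
  · rw [inl_twoDesc, whisker_exchange_assoc, inl_twoDesc]; simp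
  · rw [inr_twoDesc, whisker_exchange_assoc, inr_twoDesc]; simp

theorem twoLift_comp [HasBinaryProducts C] [HasBinaryCoproducts C] {X Y Y' : C}
    (f : X ⊗ (𝟙_ C ⨿ 𝟙_ C) ⟶ Y) (g : Y ⟶ Y') : twoLift (f ≫ g) = twoLift f ≫ prod.map g g := by
  simp [twoLift]

/-- The functor `X ↦ X × X` is right adjoint to `- ⊗ (1 + 1)`, since `X ⊗ (1 + 1) ≅ X + X`. -/
def twoAdj [HasBinaryProducts C] [HasBinaryCoproducts C]
    [∀ X : C, PreservesFiniteColimits (tensorLeft X)] :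
    tensorRight (𝟙_ C ⨿ 𝟙_ C) ⊣ square (C := C) :=
  Adjunction.mkOfHomEquiv
    { homEquiv := fun X Y => twoEquiv X Y
      homEquiv_naturality_left_symm := fun f g => twoDesc_comp f g
      homEquiv_naturality_right := fun f g => twoLift_comp f g }

theorem twoAdj_homEquiv_apply [HasBinaryProducts C] [HasBinaryCoproducts C]
    [∀ X : C, PreservesFiniteColimits (tensorLeft X)] {X Y : C}
    (f : X ⊗ (𝟙_ C ⨿ 𝟙_ C) ⟶ Y) : twoAdj.homEquiv X Y f = twoLift f := by
  rw [twoAdj, Adjunction.mkOfHomEquiv_homEquiv]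
  rfl

/-- Given right adjoints `H` of `- ⊗ U` and `H'` of `- ⊗ V` and a map `j : U ⟶ V`, this is the map
`hom(j, -) : hom(V, -) ⟶ hom(U, -)`. -/
def homPre {U V : C} {H H' : C ⥤ C} (adjV : tensorRight V ⊣ H') (adjU : tensorRight U ⊣ H)
    (j : U ⟶ V) : H' ⟶ H :=
  conjugateEquiv adjV adjU ((tensoringRight C).map j)

/-- The pullback hom of `j : U ⟶ V` and `g : X ⟶ Y`, as a functor in `g`: the map
`hom(V, X) ⟶ hom(U, X) ×_{hom(U, Y)} hom(V, Y)`. -/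
def pullbackHom [HasPullbacks C] {U V : C} {H H' : C ⥤ C} (adjV : tensorRight V ⊣ H')
    (adjU : tensorRight U ⊣ H) (j : U ⟶ V) : Arrow C ⥤ Arrow C where
  obj g := Arrow.mk (pullback.lift (f := H.map g.hom) (g := (homPre adjV adjU j).app g.right)
    ((homPre adjV adjU j).app g.left) (H'.map g.hom) ((homPre adjV adjU j).naturality g.hom).symm)
  map {g h} φ := Arrow.homMk (H'.map φ.left)
    (pullback.lift (pullback.fst _ _ ≫ H.map φ.left) (pullback.snd _ _ ≫ H'.map φ.right)
      (by
        have h₁ := (homPre adjV adjU j).naturality φ.right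
        rw [Category.assoc, Category.assoc, ← H.map_comp, Arrow.w, H.map_comp, h₁,
          pullback.condition_assoc]))
    (by
      apply pullback.hom_ext
      · simp [pullback.lift_fst, pullback.lift_fst_assoc]
      · simp [pullback.lift_snd, pullback.lift_snd_assoc]
        rw [← H'.map_comp, Arrow.w, H'.map_comp])
  map_id g := by
    apply Arrow.hom_ext
    · exact H'.map_id g.left
    · apply pullback.hom_ext <;> simp
  map_comp φ ψ := by
    apply Arrow.hom_ext
    · exact H'.map_comp φ.left ψ.left
    · apply pullback.hom_ext
      · simp [pullback.lift_fst, pullback.lift_fst_assoc]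
      · simp [pullback.lift_snd, pullback.lift_snd_assoc]

namespace Interval

variable (J : Interval C)

/-- The map `[δ₀, δ₁] : 1 + 1 ⟶ I`. -/
def boundary [HasBinaryCoproducts C] : 𝟙_ C ⨿ 𝟙_ C ⟶ J.I := coprod.desc J.δ₀ J.δ₁

/-- Evaluation of paths at a point `d : 1 ⟶ I`. -/
def ev (d : 𝟙_ C ⟶ J.I) (X : C) : J.P.obj X ⟶ X :=
  (ρ_ (J.P.obj X)).inv ≫ J.P.obj X ◁ d ≫ J.adj.counit.app X

/-- The constant paths `Y ⟶ P Y`: the transpose of the projection `Y ⊗ I ⟶ Y`. -/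
def const (Y : C) : Y ⟶ J.P.obj Y :=
  J.adj.homEquiv Y Y (SemiCartesianMonoidalCategory.fst Y J.I)

theorem ev_natural (d : 𝟙_ C ⟶ J.I) {X Y : C} (f : X ⟶ Y) :
    J.P.map f ≫ J.ev d Y = J.ev d X ≫ f := by
  have h := J.adj.counit.naturality f
  dsimp at h
  simp only [ev, Category.assoc, ← h, rightUnitor_inv_naturality_assoc, whisker_exchange_assoc]

theorem const_natural {X Y : C} (f : X ⟶ Y) : f ≫ J.const Y = J.const X ≫ J.P.map f := by
  have h : f ▷ J.I ≫ SemiCartesianMonoidalCategory.fst Y J.I =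
      SemiCartesianMonoidalCategory.fst X J.I ≫ f := by
    rw [SemiCartesianMonoidalCategory.fst_def, SemiCartesianMonoidalCategory.fst_def,
      ← whisker_exchange_assoc, rightUnitor_naturality, Category.assoc]
  rw [const, const, ← J.adj.homEquiv_naturality_left, ← J.adj.homEquiv_naturality_right]
  exact congrArg _ h

theorem const_ev (d : 𝟙_ C ⟶ J.I) (X : C) : J.const X ≫ J.ev d X = 𝟙 X := by
  have h : J.const X ▷ J.I ≫ J.adj.counit.app X = SemiCartesianMonoidalCategory.fst X J.I := by
    have h := J.adj.homEquiv_counit (X := X) (g := J.const X)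
    rw [const, Equiv.symm_apply_apply] at h
    exact h.symm
  have h' : d ≫ SemiCartesianMonoidalCategory.isTerminalTensorUnit.from J.I = 𝟙 (𝟙_ C) :=
    SemiCartesianMonoidalCategory.isTerminalTensorUnit.hom_ext _ _
  rw [ev, rightUnitor_inv_naturality_assoc, ← whisker_exchange_assoc, h,
    SemiCartesianMonoidalCategory.fst_def, ← MonoidalCategory.whiskerLeft_comp_assoc, h']
  simp

theorem homPre_unit_app (d : 𝟙_ C ⟶ J.I) (X : C) :
    (homPre J.adj unitAdj d).app X = J.ev d X := by
  have h := conjugateEquiv_counit J.adj unitAdj ((tensoringRight C).map d) X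
  have h₁ : unitAdj.counit.app X = (ρ_ X).hom := by simp [unitAdj]
  rw [h₁] at h
  dsimp at h
  rw [rightUnitor_naturality] at h
  rw [ev, ← h, Iso.inv_hom_id_assoc]
  rfl

theorem homPre_boundary_app [HasBinaryProducts C] [HasBinaryCoproducts C]
    [∀ X : C, PreservesFiniteColimits (tensorLeft X)] (X : C) :
    (homPre J.adj twoAdj J.boundary).app X = prod.lift (J.ev J.δ₀ X) (J.ev J.δ₁ X) := by
  have h : twoLift (J.P.obj X ◁ J.boundary ≫ J.adj.counit.app X) =
      (homPre J.adj twoAdj J.boundary).app X := by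
    have h := conjugateEquiv_counit J.adj twoAdj ((tensoringRight C).map J.boundary) X
    have h₁ := twoAdj.homEquiv_counit (g := (homPre J.adj twoAdj J.boundary).app X)
    rw [← twoAdj_homEquiv_apply]
    exact ((Equiv.symm_apply_eq _).1 (h₁.trans h)).symm
  rw [← h, twoLift, ← MonoidalCategory.whiskerLeft_comp_assoc,
    ← MonoidalCategory.whiskerLeft_comp_assoc, boundary, coprod.inl_desc, coprod.inr_desc]
  rfl

end Interval

/-- The conditions relating a pre algebraic model structure to an interval: pullback stability of
`(C, Fᵗ)` and the three structured axioms on pushout products and pullback homs. -/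
structure Conditions [HasFiniteLimits C] [HasFiniteColimits C]
    [∀ X : C, PreservesFiniteColimits (tensorLeft X)] (M : PreAMS C) (J : Interval C) where
  pullbackStable : M.cof.PullbackStable
  /-- `m ↦ m ⊗̂ [δ₀, δ₁]` lifts to a functor from cofibrations to cofibrations. -/
  boundaryCof : FunctorialCoalgebraStructure M.cof.counit
    (CopointedCoalgebra.forget M.cof.counit ⋙
      Arrow.pushoutProduct.flip.obj (Arrow.mk J.boundary))
  /-- Pullback hom with `δ₀` lifts to a functor from fibrations to trivial fibrations. -/
  endpointTrivFib₀ : FunctorialAlgebraStructure M.cof.mul.monad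
    (M.trivCof.mul.monad.forget ⋙ pullbackHom J.adj unitAdj J.δ₀)
  /-- Pullback hom with `δ₁` lifts to a functor from fibrations to trivial fibrations. -/
  endpointTrivFib₁ : FunctorialAlgebraStructure M.cof.mul.monad
    (M.trivCof.mul.monad.forget ⋙ pullbackHom J.adj unitAdj J.δ₁)
  /-- Pullback hom with `[δ₀, δ₁]` lifts to a functor from fibrations to fibrations. -/
  boundaryFib : FunctorialAlgebraStructure M.trivCof.mul.monad
    (M.trivCof.mul.monad.forget ⋙ pullbackHom J.adj twoAdj J.boundary)

/-! ### The mapping path space and identity types -/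

namespace Interval

variable (J : Interval C) [HasPullbacks C]

/-- The mapping path space `P_Y(X)` of `f : X ⟶ Y`: the pullback of `P f : P X ⟶ P Y` along the
constant paths `Y ⟶ P Y`. -/
@[simps]
abbrev mappingPath : Arrow C ⥤ C where
  obj f := pullback (J.const f.right) (J.P.map f.hom)
  map {f g} φ := pullback.lift (pullback.fst (J.const f.right) (J.P.map f.hom) ≫ φ.right)
    (pullback.snd (J.const f.right) (J.P.map f.hom) ≫ J.P.map φ.left)
    (by
      rw [Category.assoc, Category.assoc, J.const_natural, ← J.P.map_comp, Arrow.w, J.P.map_comp,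
        pullback.condition_assoc])
  map_id f := by apply pullback.hom_ext <;> simp
  map_comp φ ψ := by
    apply pullback.hom_ext
    · simp [pullback.lift_fst, pullback.lift_fst_assoc]
    · simp [pullback.lift_snd, pullback.lift_snd_assoc]

/-- The reflexivity map `r : X ⟶ P_Y(X)`. -/
def refl (f : Arrow C) : f.left ⟶ J.mappingPath.obj f :=
  pullback.lift f.hom (J.const f.left) (J.const_natural f.hom)

theorem refl_natural {f g : Arrow C} (φ : f ⟶ g) :
    φ.left ≫ J.refl g = J.refl f ≫ J.mappingPath.map φ := by
  apply pullback.hom_ext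
  · simp [refl, pullback.lift_fst, pullback.lift_fst_assoc]
  · simp [refl, pullback.lift_snd, pullback.lift_snd_assoc, J.const_natural]

/-- The functor `f ↦ (r : X ⟶ P_Y(X))`. -/
@[simps]
abbrev reflFunctor : Arrow C ⥤ Arrow C where
  obj f := Arrow.mk (J.refl f)
  map φ := Arrow.homMk φ.left (J.mappingPath.map φ) (J.refl_natural φ)
  map_id f := by
    apply Arrow.hom_ext
    · rfl
    · exact J.mappingPath.map_id f
  map_comp φ ψ := by
    apply Arrow.hom_ext
    · rfl
    · exact J.mappingPath.map_comp φ ψ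

/-- The projections `P_Y(X) ⟶ X` given by evaluation at a point of the interval. -/
def proj (d : 𝟙_ C ⟶ J.I) (f : Arrow C) : J.mappingPath.obj f ⟶ f.left :=
  pullback.snd (J.const f.right) (J.P.map f.hom) ≫ J.ev d f.left

/-- The projections are maps over `Y`. -/
theorem proj_over (d : 𝟙_ C ⟶ J.I) (f : Arrow C) :
    J.proj d f ≫ f.hom = pullback.fst (J.const f.right) (J.P.map f.hom) := by
  rw [proj, Category.assoc, ← J.ev_natural, ← pullback.condition_assoc, J.const_ev,
    Category.comp_id]

/-- The projections are retractions of the reflexivity map. -/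
theorem refl_proj (d : 𝟙_ C ⟶ J.I) (f : Arrow C) : J.refl f ≫ J.proj d f = 𝟙 f.left := by
  rw [refl, proj, pullback.lift_snd_assoc, J.const_ev]

theorem proj_natural (d : 𝟙_ C ⟶ J.I) {f g : Arrow C} (φ : f ⟶ g) :
    J.mappingPath.map φ ≫ J.proj d g = J.proj d f ≫ φ.left := by
  simp [proj, pullback.lift_snd_assoc, J.ev_natural]

/-- The map `⟨p₀, p₁⟩ : P_Y(X) ⟶ X ×_Y X`. -/
def endpoints (f : Arrow C) : J.mappingPath.obj f ⟶ fibreSquare.obj f :=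
  pullback.lift (J.proj J.δ₀ f) (J.proj J.δ₁ f) (by rw [proj_over, proj_over])

theorem refl_endpoints (f : Arrow C) : J.refl f ≫ J.endpoints f = pullback.diagonal f.hom := by
  apply pullback.hom_ext
  · simp [endpoints, pullback.lift_fst, refl_proj]
  · simp [endpoints, pullback.lift_snd, refl_proj]

theorem endpoints_natural {f g : Arrow C} (φ : f ⟶ g) :
    J.mappingPath.map φ ≫ J.endpoints g = J.endpoints f ≫ fibreSquare.map φ := by
  apply pullback.hom_ext
  · rw [Category.assoc, Category.assoc, fibreSquare_map, endpoints, endpoints, pullback.lift_fst,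
      pullback.lift_fst, pullback.lift_fst_assoc, proj_natural]
  · rw [Category.assoc, Category.assoc, fibreSquare_map, endpoints, endpoints, pullback.lift_snd,
      pullback.lift_snd, pullback.lift_snd_assoc, proj_natural]

/-- The factorisation `X ⟶ Id_Y(X) ⟶ X ×_Y X` of the diagonal of `f : X ⟶ Y`, where
`X ⟶ Id_Y(X) ⟶ P_Y(X)` is the `(C₁, F₁ᵗ)`-factorisation of the reflexivity map `r : X ⟶ P_Y(X)`,
and `Id_Y(X) ⟶ X ×_Y X` is the composite with `⟨p₀, p₁⟩ : P_Y(X) ⟶ X ×_Y X`. -/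
@[simps]
abbrev idFactorisation (Ψ : FunctorialFactorisation C) (Φ : AWFS C) : DiagonalFactorisation Φ where
  P := Φ.mul.monad.forget ⋙ J.reflFunctor ⋙ Ψ.K
  r f := Ψ.L (J.reflFunctor.obj f.A)
  p f := Ψ.R (J.reflFunctor.obj f.A) ≫ J.endpoints f.A
  fac f := by
    have h := Ψ.fac (J.reflFunctor.obj f.A)
    exact ((Category.assoc _ _ _).symm.trans (congrArg (fun s => s ≫ J.endpoints f.A) h)).trans
      (J.refl_endpoints f.A)
  r_natural φ := Ψ.L_natural (J.reflFunctor.map φ.f)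
  p_natural {f g} φ := by
    have h := Ψ.R_natural (J.reflFunctor.map φ.f)
    have h' := J.endpoints_natural φ.f
    exact (((Category.assoc _ _ _).symm.trans (congrArg (fun s => s ≫ J.endpoints g.A) h)).trans
      (Category.assoc _ _ _)).trans ((congrArg (fun s => Ψ.R _ ≫ s) h').trans
        (Category.assoc _ _ _).symm)

end Interval

end Interval

end

end AlgFact

namespace AlgFact

variable {C : Type u} [Category.{v} C]

namespace FunctorialFactorisation

/-! ### Unbundled pointed algebras, copointed coalgebras and lifts -/

section Lifting

variable (Φ : FunctorialFactorisation C)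

/-- A structure of algebra for the pointed endofunctor `R` on `f`, given by its domain part. -/
structure Alg (f : Arrow C) where
  /-- the domain part of the structure map -/
  s : Φ.K.obj f ⟶ f.left
  L_s : Φ.L f ≫ s = 𝟙 f.left
  s_hom : s ≫ f.hom = Φ.R f

/-- A structure of coalgebra for the copointed endofunctor `L` on `f`, given by its codomain
part. -/
structure Coalg (f : Arrow C) where
  /-- the codomain part of the structure map -/
  k : f.right ⟶ Φ.K.obj f
  hom_k : f.hom ≫ k = Φ.L f
  k_R : k ≫ Φ.R f = 𝟙 f.right

variable {Φ}

theorem L_natural_assoc {f g : Arrow C} (φ : f ⟶ g) {Z : C} (t : Φ.K.obj g ⟶ Z) :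
    φ.left ≫ Φ.L g ≫ t = Φ.L f ≫ Φ.K.map φ ≫ t :=
  (reassoc_of% (Φ.L_natural φ)) t

theorem R_natural_assoc {f g : Arrow C} (φ : f ⟶ g) {Z : C} (t : g.right ⟶ Z) :
    Φ.K.map φ ≫ Φ.R g ≫ t = Φ.R f ≫ φ.right ≫ t :=
  (reassoc_of% (Φ.R_natural φ)) t

theorem Alg.s_hom_assoc {f : Arrow C} (S : Φ.Alg f) {Z : C} (t : f.right ⟶ Z) :
    S.s ≫ f.hom ≫ t = Φ.R f ≫ t :=
  (reassoc_of% S.s_hom) t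

theorem Coalg.hom_k_assoc {f : Arrow C} (S : Φ.Coalg f) {Z : C} (t : Φ.K.obj f ⟶ Z) :
    f.hom ≫ S.k ≫ t = Φ.L f ≫ t :=
  (reassoc_of% S.hom_k) t

theorem Coalg.k_R_assoc {f : Arrow C} (S : Φ.Coalg f) {Z : C} (t : f.right ⟶ Z) :
    S.k ≫ Φ.R f ≫ t = t := by
  rw [← Category.assoc, S.k_R, Category.id_comp]

theorem K_map_comp_eq {f g h : Arrow C} (φ : f ⟶ g) (ψ : g ⟶ h) (χ : f ⟶ h)
    (hl : φ.left ≫ ψ.left = χ.left) (hr : φ.right ≫ ψ.right = χ.right) :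
    Φ.K.map φ ≫ Φ.K.map ψ = Φ.K.map χ := by
  rw [← Φ.K.map_comp]
  exact congrArg _ (Arrow.hom_ext _ _ hl hr)

theorem K_map_comp_eq_assoc {f g h : Arrow C} (φ : f ⟶ g) (ψ : g ⟶ h) (χ : f ⟶ h)
    (hl : φ.left ≫ ψ.left = χ.left) (hr : φ.right ≫ ψ.right = χ.right) {Z : C}
    (t : Φ.K.obj h ⟶ Z) : Φ.K.map φ ≫ Φ.K.map ψ ≫ t = Φ.K.map χ ≫ t := by
  rw [← Category.assoc, K_map_comp_eq φ ψ χ hl hr]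

/-- The structure map of an algebra, as a square. -/
abbrev Alg.structureMap {f : Arrow C} (S : Φ.Alg f) : Arrow.mk (Φ.R f) ⟶ f :=
  Arrow.homMk S.s (𝟙 f.right) (S.s_hom.trans (Category.comp_id (Φ.R f)).symm)

/-- `φ` is a morphism of algebras. -/
def Alg.IsHom {f g : Arrow C} (S : Φ.Alg f) (T : Φ.Alg g) (φ : f ⟶ g) : Prop :=
  Φ.K.map φ ≫ T.s = S.s ≫ φ.left

/-- `φ` is a morphism of coalgebras. -/
def Coalg.IsHom {f g : Arrow C} (S : Φ.Coalg f) (T : Φ.Coalg g) (φ : f ⟶ g) : Prop :=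
  φ.right ≫ T.k = S.k ≫ Φ.K.map φ

/-- The diagonal filler of a square from a coalgebra to an algebra. -/
def lift {f g : Arrow C} (S : Φ.Coalg f) (T : Φ.Alg g) (φ : f ⟶ g) : f.right ⟶ g.left :=
  S.k ≫ Φ.K.map φ ≫ T.s

theorem hom_lift {f g : Arrow C} (S : Φ.Coalg f) (T : Φ.Alg g) (φ : f ⟶ g) :
    f.hom ≫ lift S T φ = φ.left := by
  rw [lift, S.hom_k_assoc, ← Φ.L_natural_assoc, T.L_s, Category.comp_id]

theorem lift_hom {f g : Arrow C} (S : Φ.Coalg f) (T : Φ.Alg g) (φ : f ⟶ g) :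
    lift S T φ ≫ g.hom = φ.right := by
  rw [lift, Category.assoc, Category.assoc, T.s_hom, Φ.R_natural, S.k_R_assoc]

theorem lift_natural {f g f' g' : Arrow C} {S : Φ.Coalg f} {T : Φ.Alg g} {S' : Φ.Coalg f'}
    {T' : Φ.Alg g'} {α : f ⟶ f'} {β : g ⟶ g'} (hα : S.IsHom S' α) (hβ : T.IsHom T' β)
    (φ : f ⟶ g) (φ' : f' ⟶ g') (h : α ≫ φ' = φ ≫ β) :
    α.right ≫ lift S' T' φ' = lift S T φ ≫ β.left := by
  rw [Coalg.IsHom] at hα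
  rw [Alg.IsHom] at hβ
  rw [lift, lift, reassoc_of% hα, ← Φ.K.map_comp_assoc, h, Φ.K.map_comp_assoc, hβ]
  simp only [Category.assoc]

/-- Algebra structures can be pulled back. -/
noncomputable def Alg.pullback {f g : Arrow C} (T : Φ.Alg g) (φ : f ⟶ g)
    (h : IsPullback φ.left f.hom g.hom φ.right) : Φ.Alg f where
  s := h.lift (Φ.K.map φ ≫ T.s) (Φ.R f)
    (by rw [Category.assoc, T.s_hom, Φ.R_natural])
  L_s := by
    apply h.hom_ext
    · rw [Category.assoc, h.lift_fst, ← Φ.L_natural_assoc, T.L_s, Category.comp_id,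
        Category.id_comp]
    · rw [Category.assoc, h.lift_snd, Φ.fac, Category.id_comp]
  s_hom := h.lift_snd _ _ _

theorem Alg.pullback_isHom {f g : Arrow C} (T : Φ.Alg g) (φ : f ⟶ g)
    (h : IsPullback φ.left f.hom g.hom φ.right) : (T.pullback φ h).IsHom T φ :=
  (h.lift_fst _ _ _).symm

theorem Alg.IsHom.comp {f g h : Arrow C} {S : Φ.Alg f} {T : Φ.Alg g} {U : Φ.Alg h}
    {φ : f ⟶ g} {ψ : g ⟶ h} (hφ : S.IsHom T φ) (hψ : T.IsHom U ψ) : S.IsHom U (φ ≫ ψ) := by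
  rw [Alg.IsHom] at *
  rw [Φ.K.map_comp, Category.assoc, hψ, reassoc_of% hφ, Arrow.comp_left]

theorem Alg.IsHom.of_isPullback {f g h : Arrow C} {S : Φ.Alg f} {T : Φ.Alg g} {U : Φ.Alg h}
    {φ : f ⟶ g} {ψ : g ⟶ h} (hψ : T.IsHom U ψ) (hp : IsPullback ψ.left g.hom h.hom ψ.right)
    (hφψ : S.IsHom U (φ ≫ ψ)) : S.IsHom T φ := by
  rw [Alg.IsHom] at *
  apply hp.hom_ext
  · rw [Category.assoc, ← hψ, ← Φ.K.map_comp_assoc, hφψ, Arrow.comp_left, Category.assoc]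
  · rw [Category.assoc, T.s_hom, Φ.R_natural, Category.assoc, Arrow.w, S.s_hom_assoc]

/-- The pullbacks of algebra structures are functorial. -/
theorem Alg.IsHom.pullback {f g f' g' : Arrow C} {T : Φ.Alg g} {T' : Φ.Alg g'} {φ : f ⟶ g}
    {φ' : f' ⟶ g'} {h : IsPullback φ.left f.hom g.hom φ.right}
    {h' : IsPullback φ'.left f'.hom g'.hom φ'.right} {α : f ⟶ f'} {β : g ⟶ g'}
    (hβ : T.IsHom T' β) (hαβ : α ≫ φ' = φ ≫ β) :
    (T.pullback φ h).IsHom (T'.pullback φ' h') α :=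
  (T'.pullback_isHom φ' h').of_isPullback h' (hαβ ▸ (T.pullback_isHom φ h).comp hβ)

/-- Restriction of algebra structures along a morphism of functorial factorisations. -/
def Hom.alg {Ψ : FunctorialFactorisation C} (ζ : Φ.Hom Ψ) {f : Arrow C} (T : Ψ.Alg f) :
    Φ.Alg f where
  s := ζ.app f ≫ T.s
  L_s := by rw [← Category.assoc, ζ.L_app, T.L_s]
  s_hom := by rw [Category.assoc, T.s_hom, ζ.app_R]

theorem Alg.IsHom.map {Ψ : FunctorialFactorisation C} (ζ : Φ.Hom Ψ) {f g : Arrow C}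
    {S : Ψ.Alg f} {T : Ψ.Alg g} {φ : f ⟶ g} (h : S.IsHom T φ) :
    (ζ.alg S).IsHom (ζ.alg T) φ := by
  rw [Alg.IsHom] at *
  dsimp only [Hom.alg]
  rw [← Category.assoc, ζ.natural, Category.assoc, Category.assoc, h]

end Lifting

/-! ### Comonad and monad structures -/

section Monads

variable {Φ : FunctorialFactorisation C}

namespace Comultiplication

variable (c : Φ.Comultiplication)

/-- The codomain part of the comultiplication. -/
abbrev d (f : Arrow C) : Φ.K.obj f ⟶ Φ.K.obj (Arrow.mk (Φ.L f)) := (c.δ.app f).right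

theorem δ_left (f : Arrow C) : (c.δ.app f).left = 𝟙 f.left := by
  have h := congrArg (fun s => s.left) (c.left_counit f)
  simpa using h

theorem L_d (f : Arrow C) : Φ.L f ≫ c.d f = Φ.L (Arrow.mk (Φ.L f)) := by
  have h := Arrow.w (c.δ.app f)
  rw [δ_left] at h
  exact h.symm.trans (Category.id_comp _)

theorem d_R (f : Arrow C) : c.d f ≫ Φ.R (Arrow.mk (Φ.L f)) = 𝟙 _ :=
  congrArg (fun s => s.right) (c.left_counit f)

theorem d_natural {f g : Arrow C} (φ : f ⟶ g) :
    Φ.K.map φ ≫ c.d g = c.d f ≫ Φ.K.map (Φ.left.map φ) :=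
  congrArg (fun s => s.right) (c.δ.naturality φ)

theorem L_d_assoc (f : Arrow C) {Z : C} (t : Φ.K.obj (Arrow.mk (Φ.L f)) ⟶ Z) :
    Φ.L f ≫ c.d f ≫ t = Φ.L (Arrow.mk (Φ.L f)) ≫ t :=
  (reassoc_of% (c.L_d f)) t

theorem d_R_assoc (f : Arrow C) {Z : C} (t : Φ.K.obj f ⟶ Z) :
    c.d f ≫ Φ.R (Arrow.mk (Φ.L f)) ≫ t = t := by
  rw [← Category.assoc, c.d_R, Category.id_comp]

theorem d_natural_assoc {f g : Arrow C} (φ : f ⟶ g) {Z : C}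
    (t : Φ.K.obj (Arrow.mk (Φ.L g)) ⟶ Z) :
    Φ.K.map φ ≫ c.d g ≫ t = c.d f ≫ Φ.K.map (Φ.left.map φ) ≫ t :=
  (reassoc_of% (c.d_natural φ)) t

/-- The cofree coalgebra structure on `L f`. -/
def coalg (f : Arrow C) : Φ.Coalg (Arrow.mk (Φ.L f)) where
  k := c.d f
  hom_k := c.L_d f
  k_R := c.d_R f

theorem coalg_isHom {f g : Arrow C} (φ : f ⟶ g) :
    (c.coalg f).IsHom (c.coalg g) (Φ.left.map φ) :=
  c.d_natural φ

end Comultiplication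

namespace Multiplication

variable (m : Φ.Multiplication)

/-- The domain part of the multiplication. -/
abbrev e (f : Arrow C) : Φ.K.obj (Arrow.mk (Φ.R f)) ⟶ Φ.K.obj f := (m.μ.app f).left

theorem μ_right (f : Arrow C) : (m.μ.app f).right = 𝟙 f.right := by
  have h := congrArg (fun s => s.right) (m.left_unit f)
  simpa using h

theorem e_R (f : Arrow C) : m.e f ≫ Φ.R f = Φ.R (Arrow.mk (Φ.R f)) := by
  have h := Arrow.w (m.μ.app f)
  rw [μ_right] at h
  exact h.trans (Category.comp_id _)

theorem L_e (f : Arrow C) : Φ.L (Arrow.mk (Φ.R f)) ≫ m.e f = 𝟙 _ :=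
  congrArg (fun s => s.left) (m.left_unit f)

theorem e_natural {f g : Arrow C} (φ : f ⟶ g) :
    Φ.K.map (Φ.right.map φ) ≫ m.e g = m.e f ≫ Φ.K.map φ :=
  congrArg (fun s => s.left) (m.μ.naturality φ)

theorem e_natural_assoc {f g : Arrow C} (φ : f ⟶ g) {Z : C} (t : Φ.K.obj g ⟶ Z) :
    Φ.K.map (Φ.right.map φ) ≫ m.e g ≫ t = m.e f ≫ Φ.K.map φ ≫ t :=
  (reassoc_of% (m.e_natural φ)) t

/-- The free algebra structure on `R f`. -/
def alg (f : Arrow C) : Φ.Alg (Arrow.mk (Φ.R f)) where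
  s := m.e f
  L_s := m.L_e f
  s_hom := m.e_R f

theorem alg_isHom {f g : Arrow C} (φ : f ⟶ g) :
    (m.alg f).IsHom (m.alg g) (Φ.right.map φ) :=
  m.e_natural φ

/-- The algebra structure is associative, that is, it is an algebra structure for the monad. -/
def IsAssoc {f : Arrow C} (S : Φ.Alg f) : Prop :=
  m.e f ≫ S.s = Φ.K.map S.structureMap ≫ S.s

variable {m}

theorem IsAssoc.pullback {f g : Arrow C} {T : Φ.Alg g} (hT : m.IsAssoc T) (φ : f ⟶ g)
    (h : IsPullback φ.left f.hom g.hom φ.right) : m.IsAssoc (T.pullback φ h) := by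
  have hφ := T.pullback_isHom φ h
  rw [Alg.IsHom] at hφ
  rw [IsAssoc] at *
  apply h.hom_ext
  · rw [Category.assoc, Category.assoc, ← hφ, ← e_natural_assoc, hT]
    rw [K_map_comp_eq_assoc _ _ (Arrow.homMk ((T.pullback φ h).s ≫ φ.left) φ.right
      (by simp [← (T.pullback φ h).s_hom]) : Arrow.mk (Φ.R f) ⟶ g) (by simp [hφ]) (by simp)]
    rw [K_map_comp_eq_assoc _ _ (Arrow.homMk ((T.pullback φ h).s ≫ φ.left) φ.right
      (by simp [← (T.pullback φ h).s_hom]) : Arrow.mk (Φ.R f) ⟶ g) (by simp) (by simp)]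
  · rw [Category.assoc, Category.assoc, (T.pullback φ h).s_hom, e_R, Φ.R_natural]
    simp

theorem algebra_right {f : Arrow C} {a : Φ.right.obj f ⟶ f} (h : Φ.unit.app f ≫ a = 𝟙 f) :
    a.right = 𝟙 f.right := by
  have h := congrArg (fun s => s.right) h
  simpa using h

/-- The domain part of an algebra for the pointed endofunctor `R`. -/
def algOfUnit {f : Arrow C} (a : Φ.right.obj f ⟶ f) (h : Φ.unit.app f ≫ a = 𝟙 f) : Φ.Alg f where
  s := a.left
  L_s := congrArg (fun s => s.left) h
  s_hom := by
    have h' := Arrow.w a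
    rw [algebra_right h] at h'
    exact h'.trans (Category.comp_id _)

theorem isAssoc_algOfUnit {f : Arrow C} (a : Φ.right.obj f ⟶ f) (h : Φ.unit.app f ≫ a = 𝟙 f)
    (h' : m.μ.app f ≫ a = Φ.right.map a ≫ a) : m.IsAssoc (algOfUnit a h) := by
  have ha : a = (algOfUnit a h).structureMap := Arrow.hom_ext _ _ rfl (algebra_right h)
  have h'' := congrArg (fun s => s.left) h'
  dsimp only [Arrow.comp_left, right_map, Arrow.homMk_left] at h''
  rw [IsAssoc, ← ha]
  exact h''

/-- The underlying algebra structure of an algebra for the monad `R`. -/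
def algOfAlgebra (M : m.monad.Algebra) : Φ.Alg M.A := algOfUnit M.a M.unit

theorem isAssoc_algOfAlgebra (M : m.monad.Algebra) : m.IsAssoc (algOfAlgebra M) :=
  isAssoc_algOfUnit M.a M.unit M.assoc

theorem isHom_algOfAlgebra {M N : m.monad.Algebra} (g : M ⟶ N) :
    (algOfAlgebra M).IsHom (algOfAlgebra N) g.f := by
  have h : Φ.right.map g.f ≫ N.a = M.a ≫ g.f := g.h
  exact congrArg (fun s => s.left) h

/-- The algebra for the monad `R` given by an associative algebra structure. -/
def IsAssoc.algebra {f : Arrow C} {S : Φ.Alg f} (h : m.IsAssoc S) : m.monad.Algebra where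
  A := f
  a := S.structureMap
  unit := Arrow.hom_ext _ _ S.L_s (Category.comp_id _)
  assoc := by
    apply Arrow.hom_ext
    · exact h
    · exact congrArg (fun s => s ≫ 𝟙 f.right) (m.μ_right f)

end Multiplication

end Monads

end FunctorialFactorisation

namespace FunctorialFactorisation

/-! ### Composition of algebras -/

section Composition

variable {Φ : FunctorialFactorisation C} (c : Φ.Comultiplication) {X Y Z : C}
  {f : X ⟶ Y} {g : Y ⟶ Z}

/-- The square from `f ≫ g` to `g` given by `f`. -/
@[simps!]
abbrev compToRight (f : X ⟶ Y) (g : Y ⟶ Z) : Arrow.mk (f ≫ g) ⟶ Arrow.mk g :=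
  Arrow.homMk f (𝟙 Z)

/-- The square from `L (f ≫ g)` to `f` induced by an algebra structure on `g`. -/
@[simps!]
abbrev compToLeft (f : X ⟶ Y) {g : Y ⟶ Z} (T : Φ.Alg (Arrow.mk g)) :
    Arrow.mk (Φ.L (Arrow.mk (f ≫ g))) ⟶ Arrow.mk f :=
  Arrow.homMk (𝟙 X) (Φ.K.map (compToRight f g) ≫ T.s) (by
    have h := L_natural_assoc (compToRight f g) T.s
    rw [T.L_s] at h
    simpa using h)

/-- The composite of algebras. -/
def Alg.comp (S : Φ.Alg (Arrow.mk f)) (T : Φ.Alg (Arrow.mk g)) : Φ.Alg (Arrow.mk (f ≫ g)) where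
  s := c.d (Arrow.mk (f ≫ g)) ≫ Φ.K.map (compToLeft f T) ≫ S.s
  L_s := by
    rw [c.L_d_assoc, ← L_natural_assoc, S.L_s]
    exact Category.comp_id _
  s_hom := by
    have h₁ := S.s_hom_assoc g
    have h₂ := T.s_hom
    have h₃ := Φ.R_natural (compToRight f g)
    have h₄ := R_natural_assoc (Φ := Φ) (compToLeft f T) g
    simp only [compToLeft_right, compToRight_right, Arrow.mk_hom, Category.assoc] at *
    rw [h₁, h₄, c.d_R_assoc, h₂, h₃]
    exact Category.comp_id _

theorem Alg.comp_s (S : Φ.Alg (Arrow.mk f)) (T : Φ.Alg (Arrow.mk g)) :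
    (S.comp c T).s = c.d (Arrow.mk (f ≫ g)) ≫ Φ.K.map (compToLeft f T) ≫ S.s := rfl

theorem Alg.comp_s_hom (S : Φ.Alg (Arrow.mk f)) (T : Φ.Alg (Arrow.mk g)) :
    (S.comp c T).s ≫ f = Φ.K.map (compToRight f g) ≫ T.s := by
  have h₁ := S.s_hom
  have h₄ := Φ.R_natural (compToLeft f T)
  simp only [comp, compToLeft_right, Arrow.mk_hom, Category.assoc] at *
  rw [h₁, h₄, c.d_R_assoc]

theorem Alg.IsHom.comp_isHom {X' Y' Z' : C} {f' : X' ⟶ Y'} {g' : Y' ⟶ Z'}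
    {S : Φ.Alg (Arrow.mk f)} {T : Φ.Alg (Arrow.mk g)} {S' : Φ.Alg (Arrow.mk f')}
    {T' : Φ.Alg (Arrow.mk g')} {α : Arrow.mk f ⟶ Arrow.mk f'} {β : Arrow.mk g ⟶ Arrow.mk g'}
    (hα : S.IsHom S' α) (hβ : T.IsHom T' β) (h : α.right = β.left)
    (φ : Arrow.mk (f ≫ g) ⟶ Arrow.mk (f' ≫ g')) (hl : φ.left = α.left)
    (hr : φ.right = β.right) : (S.comp c T).IsHom (S'.comp c T') φ := by
  rw [Alg.IsHom] at *
  have e₁ : Φ.left.map φ ≫ compToLeft f' T' = compToLeft f T ≫ α := by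
    apply Arrow.hom_ext
    · simp [hl]
    · have e₂ : φ ≫ compToRight f' g' = compToRight f g ≫ β := by
        apply Arrow.hom_ext
        · simp [hl, ← h]
        · simp [hr]
      simp only [Arrow.comp_right, Arrow.homMk_right, Category.assoc, h]
      rw [← Φ.K.map_comp_assoc, e₂, Φ.K.map_comp_assoc, hβ]
  dsimp only [Alg.comp]
  rw [c.d_natural_assoc, ← Φ.K.map_comp_assoc, e₁, Φ.K.map_comp_assoc, hα, hl]
  simp only [Category.assoc]

variable {c} {m : Φ.Multiplication}

/-- The left component of the compatibility of the exchange map with the multiplication. -/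
theorem e_d (h : IsDistributiveLaw c.comonad m.monad (exchange c m)) (f : Arrow C) :
    m.e f ≫ c.d f = c.d (Arrow.mk (Φ.R f)) ≫ Φ.K.map (exchange c m f) ≫
      m.e (Arrow.mk (Φ.L f)) := by
  have h' : Φ.left.map (m.μ.app f) ≫ exchange c m f = exchange c m (Arrow.mk (Φ.R f)) ≫
    Φ.right.map (exchange c m f) ≫ m.μ.app (Arrow.mk (Φ.L f)) := h.mul f
  exact congrArg (fun s => s.left) h'

theorem Multiplication.IsAssoc.comp (h : IsDistributiveLaw c.comonad m.monad (exchange c m))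
    {S : Φ.Alg (Arrow.mk f)} {T : Φ.Alg (Arrow.mk g)} (hS : m.IsAssoc S) (hT : m.IsAssoc T) :
    m.IsAssoc (S.comp c T) := by
  have hc := S.comp_s_hom c T
  have e₁ : Φ.right.map (compToRight f g) ≫ T.structureMap =
      (S.comp c T).structureMap ≫ compToRight f g := by
    apply Arrow.hom_ext
    · exact hc.symm
    · exact (Category.comp_id _).trans (Category.id_comp _).symm
  have e₂ : exchange c m (Arrow.mk (f ≫ g)) ≫ Φ.right.map (compToLeft f T) ≫ S.structureMap =
      Φ.left.map (S.comp c T).structureMap ≫ compToLeft f T := by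
    apply Arrow.hom_ext
    · exact (Category.comp_id _).symm
    · have e₃ : m.e (Arrow.mk (f ≫ g)) ≫ Φ.K.map (compToRight f g) ≫ T.s =
          Φ.K.map (S.comp c T).structureMap ≫ Φ.K.map (compToRight f g) ≫ T.s := by
        rw [← m.e_natural_assoc, hT, ← Φ.K.map_comp_assoc, e₁, Φ.K.map_comp_assoc]
      exact (congrArg (fun s => m.e _ ≫ s) (Category.comp_id _)).trans e₃
  rw [IsAssoc, Alg.comp_s, c.d_natural_assoc, ← Category.assoc, e_d h, Category.assoc, Category.assoc,
    ← m.e_natural_assoc, hS, ← Φ.K.map_comp_assoc, ← Φ.K.map_comp_assoc,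
    ← Φ.K.map_comp_assoc, Category.assoc, e₂]

end Composition

end FunctorialFactorisation

theorem IsCategoryIso.isEquivalence {A : Type u} [Category.{v} A] {B : Type w} [Category.{z} B]
    {F : A ⥤ B} (h : IsCategoryIso F) : F.IsEquivalence := by
  obtain ⟨G, h₁, h₂⟩ := h
  exact (CategoryTheory.Equivalence.mk F G (eqToIso h₁.symm) (eqToIso h₂)).isEquivalence_functor

theorem IsCategoryIso.exists_obj_eq {A : Type u} [Category.{v} A] {B : Type w} [Category.{z} B]
    {F : A ⥤ B} (h : IsCategoryIso F) (b : B) : ∃ a : A, F.obj a = b := by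
  obtain ⟨G, _, h₂⟩ := h
  exact ⟨G.obj b, Functor.congr_obj h₂ b⟩

namespace FunctorialFactorisation

/-! ### Algebraic freeness -/

section Free

variable {Φ Ψ : FunctorialFactorisation C} (ζ : Φ.Hom Ψ) {m : Ψ.Multiplication}

theorem Hom.exists_alg (h : IsCategoryIso (ζ.algebraFunctor m)) {f : Arrow C} (S : Φ.Alg f) :
    ∃ T : Ψ.Alg f, m.IsAssoc T ∧ ζ.alg T = S := by
  have key : ∀ (P : PointedAlgebra Φ.unit), ∃ T : Ψ.Alg P.X, m.IsAssoc T ∧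
      (ζ.alg T).s = P.a.left := by
    intro P
    obtain ⟨M, rfl⟩ := h.exists_obj_eq P
    exact ⟨Multiplication.algOfAlgebra M, Multiplication.isAssoc_algOfAlgebra M, rfl⟩
  obtain ⟨T, hT, e⟩ := key ⟨f, S.structureMap, Arrow.hom_ext _ _ S.L_s (Category.comp_id _)⟩
  refine ⟨T, hT, ?_⟩
  cases S
  exact (Alg.mk.injEq ..).mpr e

variable {ζ}

theorem Alg.IsHom.of_map (h : IsCategoryIso (ζ.algebraFunctor m)) {f g : Arrow C} {S : Ψ.Alg f}
    {T : Ψ.Alg g} (hS : m.IsAssoc S) (hT : m.IsAssoc T) {φ : f ⟶ g}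
    (hφ : (ζ.alg S).IsHom (ζ.alg T) φ) : S.IsHom T φ := by
  have := h.isEquivalence
  let ψ : (ζ.algebraFunctor m).obj hS.algebra ⟶ (ζ.algebraFunctor m).obj hT.algebra :=
    { f := φ
      comm := by
        apply Arrow.hom_ext
        · exact hφ
        · simp [Hom.algebraFunctor, Multiplication.IsAssoc.algebra] }
  have e : ((ζ.algebraFunctor m).preimage ψ).f = φ :=
    congrArg PointedAlgebra.Hom.f ((ζ.algebraFunctor m).map_preimage ψ)
  have h' := Multiplication.isHom_algOfAlgebra ((ζ.algebraFunctor m).preimage ψ)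
  rw [e] at h'
  exact h'

end Free

theorem Multiplication.isAssoc_alg {Φ : FunctorialFactorisation C} (m : Φ.Multiplication)
    (f : Arrow C) : m.IsAssoc (m.alg f) :=
  isAssoc_algOfUnit (f := Arrow.mk (Φ.R f)) (m.μ.app f) (m.left_unit f) (m.assoc f).symm

/-- The bundled morphism of algebras given by a morphism of algebra structures. -/
def Alg.IsHom.algebraHom {Φ : FunctorialFactorisation C} {m : Φ.Multiplication} {f g : Arrow C}
    {S : Φ.Alg f} {T : Φ.Alg g} {φ : f ⟶ g} (h : S.IsHom T φ) (hS : m.IsAssoc S)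
    (hT : m.IsAssoc T) : hS.algebra ⟶ hT.algebra where
  f := φ
  h := by
    apply Arrow.hom_ext
    · exact h
    · exact (Category.comp_id _).trans (Category.id_comp _).symm

end FunctorialFactorisation

theorem AWFS.Hom.isAssoc_alg {Φ Ψ : AWFS C} (ζ : Φ.Hom Ψ) {f : Arrow C}
    {T : Ψ.toFunctorialFactorisation.Alg f} (hT : Ψ.mul.IsAssoc T) :
    Φ.mul.IsAssoc (ζ.toHom.alg T) := by
  have h : Φ.mul.e f ≫ ζ.app f =
      (Φ.K.map (ζ.rightApp f) ≫ ζ.app (Arrow.mk (Ψ.R f))) ≫ Ψ.mul.e f :=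
    congrArg (fun s => s.left) (ζ.mul f)
  have e : ζ.rightApp f ≫ T.structureMap = (ζ.toHom.alg T).structureMap :=
    Arrow.hom_ext _ _ rfl (Category.comp_id _)
  have hs : (ζ.toHom.alg T).s = ζ.app f ≫ T.s := rfl
  rw [FunctorialFactorisation.Multiplication.IsAssoc] at *
  rw [hs, reassoc_of% h, hT, ← e, Φ.K.map_comp_assoc, ← reassoc_of% (ζ.natural T.structureMap)]

namespace FunctorialFactorisation

/-! ### Coalgebras -/

section Coalgebras

variable {Φ : FunctorialFactorisation C}

/-- The bundled coalgebra given by a coalgebra structure. -/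
def Coalg.coalgebra {f : Arrow C} (S : Φ.Coalg f) : CopointedCoalgebra Φ.counit where
  X := f
  a := Arrow.homMk (𝟙 f.left) S.k ((Category.id_comp _).trans S.hom_k.symm)
  counit := Arrow.hom_ext _ _ (Category.comp_id _) S.k_R

/-- The bundled morphism of coalgebras given by a morphism of coalgebra structures. -/
def Coalg.IsHom.coalgebraHom {f g : Arrow C} {S : Φ.Coalg f} {T : Φ.Coalg g} {φ : f ⟶ g}
    (h : S.IsHom T φ) : S.coalgebra ⟶ T.coalgebra where
  f := φ
  comm := by
    apply Arrow.hom_ext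
    · exact (Category.comp_id _).trans (Category.id_comp _).symm
    · exact h

/-- The codomain part of a coalgebra for the copointed endofunctor `L`. -/
def coalgOfCounit {f : Arrow C} (a : f ⟶ Φ.left.obj f) (h : a ≫ Φ.counit.app f = 𝟙 f) :
    Φ.Coalg f where
  k := a.right
  hom_k := by
    have h₁ : a.left = 𝟙 f.left := by simpa using congrArg (fun s => s.left) h
    have h₂ := Arrow.w a
    rw [h₁] at h₂
    exact h₂.symm.trans (Category.id_comp _)
  k_R := congrArg (fun s => s.right) h

/-- The coalgebra structure for the underlying copointed endofunctor induced by a morphism of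
functorial factorisations. -/
def Hom.coalg {Ψ : FunctorialFactorisation C} (ζ : Φ.Hom Ψ) {f : Arrow C} (S : Φ.Coalg f) :
    Ψ.Coalg f where
  k := S.k ≫ ζ.app f
  hom_k := by rw [S.hom_k_assoc, ζ.L_app]
  k_R := by rw [Category.assoc, ζ.app_R, S.k_R]

theorem Coalg.IsHom.map {Ψ : FunctorialFactorisation C} (ζ : Φ.Hom Ψ) {f g : Arrow C}
    {S : Φ.Coalg f} {T : Φ.Coalg g} {φ : f ⟶ g} (h : S.IsHom T φ) :
    (ζ.coalg S).IsHom (ζ.coalg T) φ := by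
  rw [Coalg.IsHom] at *
  dsimp only [Hom.coalg]
  rw [Category.assoc, ← ζ.natural, reassoc_of% h]

end Coalgebras

end FunctorialFactorisation

/-! ### Functorial (co)algebra structures applied to unbundled (co)algebras -/

namespace FunctorialAlgebraStructure

open FunctorialFactorisation

variable {Φ Ψ : FunctorialFactorisation C} {m : Φ.Multiplication} {m' : Ψ.Multiplication}
  {G : Arrow C ⥤ Arrow C}

/-- The lift of a functor to algebras, applied to an algebra structure. -/
def onAlg (S : FunctorialAlgebraStructure m'.monad (m.monad.forget ⋙ G)) {f : Arrow C}
    {T : Φ.Alg f} (hT : m.IsAssoc T) : Ψ.Alg (G.obj f) :=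
  Multiplication.algOfUnit (f := G.obj f) (S.act hT.algebra) (S.unit hT.algebra)

theorem isAssoc_onAlg (S : FunctorialAlgebraStructure m'.monad (m.monad.forget ⋙ G)) {f : Arrow C}
    {T : Φ.Alg f} (hT : m.IsAssoc T) : m'.IsAssoc (S.onAlg hT) :=
  Multiplication.isAssoc_algOfUnit (f := G.obj f) _ _ (S.assoc hT.algebra)

theorem isHom_onAlg (S : FunctorialAlgebraStructure m'.monad (m.monad.forget ⋙ G)) {f g : Arrow C}
    {T : Φ.Alg f} {T' : Φ.Alg g} (hT : m.IsAssoc T) (hT' : m.IsAssoc T') {φ : f ⟶ g}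
    (h : T.IsHom T' φ) : (S.onAlg hT).IsHom (S.onAlg hT') (G.map φ) := by
  have e : Ψ.right.map (G.map φ) ≫ S.act hT'.algebra = S.act hT.algebra ≫ G.map φ := S.natural (h.algebraHom hT hT')
  exact congrArg (fun s => s.left) e

end FunctorialAlgebraStructure

namespace FunctorialCoalgebraStructure

open FunctorialFactorisation

variable {Φ Ψ : FunctorialFactorisation C} {G : Arrow C ⥤ Arrow C}

/-- The lift of a functor to coalgebras, applied to a coalgebra structure. -/
def onCoalg (S : FunctorialCoalgebraStructure Ψ.counit (CopointedCoalgebra.forget Φ.counit ⋙ G))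
    {f : Arrow C} (T : Φ.Coalg f) : Ψ.Coalg (G.obj f) :=
  coalgOfCounit (f := G.obj f) (S.coact T.coalgebra) (S.counit T.coalgebra)

theorem isHom_onCoalg
    (S : FunctorialCoalgebraStructure Ψ.counit (CopointedCoalgebra.forget Φ.counit ⋙ G))
    {f g : Arrow C} {T : Φ.Coalg f} {T' : Φ.Coalg g} {φ : f ⟶ g}
    (h : T.IsHom T' φ) : (S.onCoalg T).IsHom (S.onCoalg T') (G.map φ) := by
  have e : G.map φ ≫ S.coact T'.coalgebra = S.coact T.coalgebra ≫ Ψ.left.map (G.map φ) :=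
    S.natural h.coalgebraHom
  exact congrArg (fun s => s.right) e

end FunctorialCoalgebraStructure

end AlgFact

namespace AlgFact

noncomputable section

open FunctorialFactorisation

variable {C : Type u} [Category.{v} C] [SemiCartesianMonoidalCategory C]

namespace Interval

/-! ### Paths and projections -/

section Projections

variable (J : Interval C)

theorem homEquiv_ev (d : 𝟙_ C ⟶ J.I) {X Y : C} (f : X ⊗ J.I ⟶ Y) :
    J.adj.homEquiv X Y f ≫ J.ev d Y = (ρ_ X).inv ≫ X ◁ d ≫ f := by
  have h : J.adj.homEquiv X Y f ▷ J.I ≫ J.adj.counit.app Y = f := by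
    have h := J.adj.homEquiv_counit (X := X) (g := J.adj.homEquiv X Y f)
    rw [Equiv.symm_apply_apply] at h
    exact h.symm
  rw [ev, rightUnitor_inv_naturality_assoc, ← whisker_exchange_assoc, h]

theorem whiskerLeft_fst {X Y Z : C} (d : Y ⟶ Z) :
    X ◁ d ≫ SemiCartesianMonoidalCategory.fst X Z = SemiCartesianMonoidalCategory.fst X Y := by
  rw [SemiCartesianMonoidalCategory.fst_def, SemiCartesianMonoidalCategory.fst_def,
    ← MonoidalCategory.whiskerLeft_comp_assoc]
  congr 2
  exact SemiCartesianMonoidalCategory.isTerminalTensorUnit.hom_ext _ _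

theorem fst_unit (X : C) : SemiCartesianMonoidalCategory.fst X (𝟙_ C) = (ρ_ X).hom := by
  rw [SemiCartesianMonoidalCategory.fst_def]
  have : SemiCartesianMonoidalCategory.isTerminalTensorUnit.from (𝟙_ C) = 𝟙 (𝟙_ C) :=
    SemiCartesianMonoidalCategory.isTerminalTensorUnit.hom_ext _ _
  rw [this]
  simp

theorem whiskerRight_fst {X Y Z : C} (f : X ⟶ Y) :
    f ▷ Z ≫ SemiCartesianMonoidalCategory.fst Y Z =
      SemiCartesianMonoidalCategory.fst X Z ≫ f := by
  rw [SemiCartesianMonoidalCategory.fst_def, SemiCartesianMonoidalCategory.fst_def,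
    ← whisker_exchange_assoc, rightUnitor_naturality, Category.assoc]

theorem comp_const {X Y : C} (f : X ⟶ Y) : f ≫ J.const Y =
    J.adj.homEquiv X Y (SemiCartesianMonoidalCategory.fst X J.I ≫ f) := by
  rw [const, ← J.adj.homEquiv_naturality_left]
  exact congrArg _ (whiskerRight_fst f)

end Projections

/-! ### The pushout product with the boundary of the interval -/

section Boundary

variable [HasFiniteColimits C] (J : Interval C)

theorem inl_boundary : coprod.inl ≫ J.boundary = J.δ₀ := coprod.inl_desc _ _

theorem inr_boundary : coprod.inr ≫ J.boundary = J.δ₁ := coprod.inr_desc _ _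

/-- The pushout product of `m` and the boundary of the interval. -/
def boundaryProduct (m : Arrow C) :
    pushout (m.hom ▷ (𝟙_ C ⨿ 𝟙_ C)) (m.left ◁ J.boundary) ⟶ m.right ⊗ J.I :=
  pushout.desc (m.right ◁ J.boundary) (m.hom ▷ J.I) (whisker_exchange _ _).symm

theorem inl_boundaryProduct (m : Arrow C) :
    pushout.inl _ _ ≫ J.boundaryProduct m = m.right ◁ J.boundary :=
  pushout.inl_desc _ _ _

theorem inr_boundaryProduct (m : Arrow C) :
    pushout.inr _ _ ≫ J.boundaryProduct m = m.hom ▷ J.I :=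
  pushout.inr_desc _ _ _

/-- The functoriality of the pushout product with the boundary of the interval. -/
def boundaryProductMap {m m' : Arrow C} (α : m ⟶ m') :
    Arrow.mk (J.boundaryProduct m) ⟶ Arrow.mk (J.boundaryProduct m') :=
  (Arrow.pushoutProduct.flip.obj (Arrow.mk J.boundary)).map α

theorem inl_boundaryProductMap {m m' : Arrow C} (α : m ⟶ m') :
    pushout.inl (m.hom ▷ (𝟙_ C ⨿ 𝟙_ C)) (m.left ◁ J.boundary) ≫ (J.boundaryProductMap α).left =
      α.right ▷ (𝟙_ C ⨿ 𝟙_ C) ≫ pushout.inl _ _ :=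
  IsPushout.inl_desc _ _ _ _

theorem inr_boundaryProductMap {m m' : Arrow C} (α : m ⟶ m') :
    pushout.inr (m.hom ▷ (𝟙_ C ⨿ 𝟙_ C)) (m.left ◁ J.boundary) ≫ (J.boundaryProductMap α).left =
      α.left ▷ J.I ≫ pushout.inr _ _ :=
  IsPushout.inr_desc _ _ _ _

theorem boundaryProductMap_right {m m' : Arrow C} (α : m ⟶ m') :
    (J.boundaryProductMap α).right = α.right ▷ J.I := rfl

end Boundary

/-! ### Pullback homs from an endpoint of the interval -/

section Endpoint

variable [HasPullbacks C] (J : Interval C) (d : 𝟙_ C ⟶ J.I)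

/-- The codomain of the pullback hom from `d` to `g`. -/
def endpointPullback (g : Arrow C) : C := ((pullbackHom J.adj unitAdj d).obj g).right

variable {J d}

/-- The point of an element of `endpointPullback`. -/
def endpointPullback.fst (g : Arrow C) : J.endpointPullback d g ⟶ g.left :=
  pullback.fst (C := C) ((𝟭 C).map g.hom) ((homPre J.adj unitAdj d).app g.right)

/-- The path of an element of `endpointPullback`. -/
def endpointPullback.snd (g : Arrow C) : J.endpointPullback d g ⟶ J.P.obj g.right :=
  pullback.snd (C := C) ((𝟭 C).map g.hom) ((homPre J.adj unitAdj d).app g.right)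

theorem endpointPullback.isPullback (g : Arrow C) :
    IsPullback (endpointPullback.fst (J := J) (d := d) g) (endpointPullback.snd g) g.hom
      (J.ev d g.right) := by
  rw [← J.homPre_unit_app]
  exact IsPullback.of_hasPullback (C := C) ((𝟭 C).map g.hom) ((homPre J.adj unitAdj d).app g.right)

variable (J d)

/-- The pullback hom from `d` to `g`. -/
def endpointHom (g : Arrow C) : J.P.obj g.left ⟶ J.endpointPullback d g :=
  ((pullbackHom J.adj unitAdj d).obj g).hom

theorem endpointHom_fst (g : Arrow C) :
    J.endpointHom d g ≫ endpointPullback.fst g = J.ev d g.left := by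
  rw [← J.homPre_unit_app]
  exact pullback.lift_fst _ _ _

theorem endpointHom_snd (g : Arrow C) :
    J.endpointHom d g ≫ endpointPullback.snd g = J.P.map g.hom :=
  pullback.lift_snd _ _ _

/-- The functoriality of the pullback hom from an endpoint of the interval. -/
def endpointHomMap {g g' : Arrow C} (φ : g ⟶ g') :
    Arrow.mk (J.endpointHom d g) ⟶ Arrow.mk (J.endpointHom d g') :=
  (pullbackHom J.adj unitAdj d).map φ

theorem endpointHomMap_left {g g' : Arrow C} (φ : g ⟶ g') :
    (J.endpointHomMap d φ).left = J.P.map φ.left := rfl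

theorem endpointHomMap_fst {g g' : Arrow C} (φ : g ⟶ g') :
    (J.endpointHomMap d φ).right ≫ endpointPullback.fst g' =
      endpointPullback.fst g ≫ φ.left :=
  pullback.lift_fst _ _ _

theorem endpointHomMap_snd {g g' : Arrow C} (φ : g ⟶ g') :
    (J.endpointHomMap d φ).right ≫ endpointPullback.snd g' =
      endpointPullback.snd g ≫ J.P.map φ.right :=
  pullback.lift_snd _ _ _

end Endpoint

/-! ### Pullback homs from the boundary of the interval -/

section BoundaryHom

variable [HasFiniteLimits C] [HasFiniteColimits C]
  [∀ X : C, PreservesFiniteColimits (tensorLeft X)] (J : Interval C)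

/-- The codomain of the pullback hom from the boundary of the interval to `g`. -/
def boundaryPullback (g : Arrow C) : C := ((pullbackHom J.adj twoAdj J.boundary).obj g).right

variable {J}

/-- The pair of points of an element of `boundaryPullback`. -/
def boundaryPullback.fst (g : Arrow C) : J.boundaryPullback g ⟶ g.left ⨯ g.left :=
  pullback.fst (C := C) (square.map g.hom) ((homPre J.adj twoAdj J.boundary).app g.right)

/-- The path of an element of `boundaryPullback`. -/
def boundaryPullback.snd (g : Arrow C) : J.boundaryPullback g ⟶ J.P.obj g.right :=
  pullback.snd (C := C) (square.map g.hom) ((homPre J.adj twoAdj J.boundary).app g.right)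

theorem boundaryPullback.isPullback (g : Arrow C) :
    IsPullback (boundaryPullback.fst (J := J) g) (boundaryPullback.snd g)
      (prod.map g.hom g.hom) (prod.lift (J.ev J.δ₀ g.right) (J.ev J.δ₁ g.right)) := by
  rw [← J.homPre_boundary_app]
  exact IsPullback.of_hasPullback (C := C) (square.map g.hom)
    ((homPre J.adj twoAdj J.boundary).app g.right)

variable (J)

/-- The pullback hom from the boundary of the interval to `g`. -/
def boundaryHom (g : Arrow C) : J.P.obj g.left ⟶ J.boundaryPullback g :=
  ((pullbackHom J.adj twoAdj J.boundary).obj g).hom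

theorem boundaryHom_fst (g : Arrow C) :
    J.boundaryHom g ≫ boundaryPullback.fst g =
      prod.lift (J.ev J.δ₀ g.left) (J.ev J.δ₁ g.left) := by
  rw [← J.homPre_boundary_app]
  exact pullback.lift_fst _ _ _

theorem boundaryHom_snd (g : Arrow C) :
    J.boundaryHom g ≫ boundaryPullback.snd g = J.P.map g.hom :=
  pullback.lift_snd _ _ _

/-- The functoriality of the pullback hom from the boundary of the interval. -/
def boundaryHomMap {g g' : Arrow C} (φ : g ⟶ g') :
    Arrow.mk (J.boundaryHom g) ⟶ Arrow.mk (J.boundaryHom g') :=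
  (pullbackHom J.adj twoAdj J.boundary).map φ

theorem boundaryHomMap_fst {g g' : Arrow C} (φ : g ⟶ g') :
    (J.boundaryHomMap φ).right ≫ boundaryPullback.fst g' =
      boundaryPullback.fst g ≫ prod.map φ.left φ.left :=
  pullback.lift_fst _ _ _

theorem boundaryHomMap_snd {g g' : Arrow C} (φ : g ⟶ g') :
    (J.boundaryHomMap φ).right ≫ boundaryPullback.snd g' =
      boundaryPullback.snd g ≫ J.P.map φ.right :=
  pullback.lift_snd _ _ _

end BoundaryHom

end Interval

namespace Conditions

variable [HasFiniteLimits C] [HasFiniteColimits C]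
  [∀ X : C, PreservesFiniteColimits (tensorLeft X)] {M : PreAMS C} {J : Interval C}
  (hM : Conditions M J)

/-- The coalgebra structure on the pushout product with the boundary of the interval. -/
def boundaryCoalg {m : Arrow C} (S : M.cof.Coalg m) :
    M.cof.Coalg (Arrow.mk (J.boundaryProduct m)) :=
  hM.boundaryCof.onCoalg S

theorem isHom_boundaryCoalg {m m' : Arrow C} {S : M.cof.Coalg m} {S' : M.cof.Coalg m'}
    {α : m ⟶ m'} (h : S.IsHom S' α) :
    (hM.boundaryCoalg S).IsHom (hM.boundaryCoalg S') (J.boundaryProductMap α) :=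
  hM.boundaryCof.isHom_onCoalg h

/-- The `Fᵗ`-algebra structure on the pullback hom from the first endpoint. -/
def endpointAlg {g : Arrow C} {T : M.trivCof.Alg g} (hT : M.trivCof.mul.IsAssoc T) :
    M.cof.Alg (Arrow.mk (J.endpointHom J.δ₀ g)) :=
  hM.endpointTrivFib₀.onAlg hT

theorem isHom_endpointAlg {g g' : Arrow C} {T : M.trivCof.Alg g} {T' : M.trivCof.Alg g'}
    (hT : M.trivCof.mul.IsAssoc T) (hT' : M.trivCof.mul.IsAssoc T') {φ : g ⟶ g'}
    (h : T.IsHom T' φ) :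
    (hM.endpointAlg hT).IsHom (hM.endpointAlg hT') (J.endpointHomMap J.δ₀ φ) :=
  hM.endpointTrivFib₀.isHom_onAlg hT hT' h

/-- The `F`-algebra structure on the pullback hom from the boundary of the interval. -/
def boundaryAlg {g : Arrow C} {T : M.trivCof.Alg g} (hT : M.trivCof.mul.IsAssoc T) :
    M.trivCof.Alg (Arrow.mk (J.boundaryHom g)) :=
  hM.boundaryFib.onAlg hT

theorem isAssoc_boundaryAlg {g : Arrow C} {T : M.trivCof.Alg g}
    (hT : M.trivCof.mul.IsAssoc T) : M.trivCof.mul.IsAssoc (hM.boundaryAlg hT) :=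
  hM.boundaryFib.isAssoc_onAlg hT

theorem isHom_boundaryAlg {g g' : Arrow C} {T : M.trivCof.Alg g} {T' : M.trivCof.Alg g'}
    (hT : M.trivCof.mul.IsAssoc T) (hT' : M.trivCof.mul.IsAssoc T') {φ : g ⟶ g'}
    (h : T.IsHom T' φ) :
    (hM.boundaryAlg hT).IsHom (hM.boundaryAlg hT') (J.boundaryHomMap φ) :=
  hM.boundaryFib.isHom_onAlg hT hT' h

end Conditions

/-! ### Trivial cofibration structures on strong deformation retracts -/

section Retract

open AlgFact.Interval

variable [HasFiniteLimits C] [HasFiniteColimits C]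
  [∀ X : C, PreservesFiniteColimits (tensorLeft X)] {M : PreAMS C} {J : Interval C}
  (hM : Conditions M J)

theorem whiskerRight_twoDesc_comp {X X' Y Y' : C} (f : X ⟶ X') (a b : X' ⟶ Y') (a' b' : X ⟶ Y)
    (h : Y ⟶ Y') (ha : f ≫ a = a' ≫ h) (hb : f ≫ b = b' ≫ h) :
    f ▷ (𝟙_ C ⨿ 𝟙_ C) ≫ twoDesc (prod.lift a b) = twoDesc (prod.lift a' b') ≫ h := by
  apply tensorTwo_hom_ext
  · rw [whisker_exchange_assoc, inl_twoDesc, ← Category.assoc (X ◁ _), inl_twoDesc,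
      prod.lift_fst, prod.lift_fst, rightUnitor_naturality_assoc, ha, Category.assoc]
  · rw [whisker_exchange_assoc, inr_twoDesc, ← Category.assoc (X ◁ _), inr_twoDesc,
      prod.lift_snd, prod.lift_snd, rightUnitor_naturality_assoc, hb, Category.assoc]

theorem twoDesc_lift_self {X Y : C} (a : X ⟶ Y) :
    twoDesc (prod.lift a a) =
      SemiCartesianMonoidalCategory.fst X (𝟙_ C ⨿ 𝟙_ C) ≫ a := by
  apply tensorTwo_hom_ext
  · rw [inl_twoDesc, prod.lift_fst, ← Category.assoc, whiskerLeft_fst, fst_unit]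
  · rw [inr_twoDesc, prod.lift_snd, ← Category.assoc, whiskerLeft_fst, fst_unit]

theorem twoDesc_lift_comp {X Y Z : C} (a b : X ⟶ Y) (h : Y ⟶ Z) :
    twoDesc (prod.lift a b) ≫ h = twoDesc (prod.lift (a ≫ h) (b ≫ h)) := by
  have := whiskerRight_twoDesc_comp (𝟙 X) (a ≫ h) (b ≫ h) a b h (by simp) (by simp)
  rw [← this]
  simp

/-- The square from `m ⊗̂ [δ₀, δ₁]` to a retraction `q` of `m` whose fillers are homotopies from
`q ≫ m` to the identity. -/
def homotopySquare (J : Interval C) (m : Arrow C) (q : m.right ⟶ m.left)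
    (hq : m.hom ≫ q = 𝟙 m.left) : Arrow.mk (J.boundaryProduct m) ⟶ Arrow.mk q :=
  Arrow.homMk
    (pushout.desc (f := m.hom ▷ (𝟙_ C ⨿ 𝟙_ C)) (g := m.left ◁ J.boundary)
      (twoDesc (prod.lift (q ≫ m.hom) (𝟙 m.right)))
      (SemiCartesianMonoidalCategory.fst m.left J.I ≫ m.hom) (by
        rw [whiskerRight_twoDesc_comp m.hom _ _ (𝟙 m.left) (𝟙 m.left) m.hom
          (by rw [reassoc_of% hq, Category.id_comp]) (by simp), twoDesc_lift_self,
          Category.comp_id, reassoc_of% (whiskerLeft_fst (X := m.left) J.boundary)]))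
    (SemiCartesianMonoidalCategory.fst m.right J.I ≫ q) (by
      apply pushout.hom_ext
      · rw [pushout.inl_desc_assoc]
        simp only [Arrow.mk_hom]
        rw [← Category.assoc, inl_boundaryProduct, twoDesc_lift_comp, Category.assoc, hq,
          Category.comp_id, Category.id_comp, twoDesc_lift_self, reassoc_of%
            (whiskerLeft_fst (X := m.right) J.boundary)]
      · rw [pushout.inr_desc_assoc]
        simp only [Arrow.mk_hom]
        rw [← Category.assoc (pushout.inr _ _), inr_boundaryProduct, ← Category.assoc (_ ▷ _),
          whiskerRight_fst, Category.assoc])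

theorem inl_homotopySquare {m : Arrow C} {q : m.right ⟶ m.left} (hq : m.hom ≫ q = 𝟙 m.left) :
    pushout.inl (m.hom ▷ (𝟙_ C ⨿ 𝟙_ C)) (m.left ◁ J.boundary) ≫ (homotopySquare J m q hq).left =
      twoDesc (prod.lift (q ≫ m.hom) (𝟙 m.right)) :=
  pushout.inl_desc _ _ _

theorem inr_homotopySquare {m : Arrow C} {q : m.right ⟶ m.left} (hq : m.hom ≫ q = 𝟙 m.left) :
    pushout.inr (m.hom ▷ (𝟙_ C ⨿ 𝟙_ C)) (m.left ◁ J.boundary) ≫ (homotopySquare J m q hq).left =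
      SemiCartesianMonoidalCategory.fst m.left J.I ≫ m.hom :=
  pushout.inr_desc _ _ _

theorem homotopySquare_right {m : Arrow C} {q : m.right ⟶ m.left} (hq : m.hom ≫ q = 𝟙 m.left) :
    (homotopySquare J m q hq).right = SemiCartesianMonoidalCategory.fst m.right J.I ≫ q := rfl

theorem homotopySquare_natural {m m' : Arrow C} {q : m.right ⟶ m.left}
    {q' : m'.right ⟶ m'.left} (hq : m.hom ≫ q = 𝟙 m.left) (hq' : m'.hom ≫ q' = 𝟙 m'.left)
    (α : m ⟶ m') (β : Arrow.mk q ⟶ Arrow.mk q') (hl : β.left = α.right)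
    (hr : β.right = α.left) :
    J.boundaryProductMap α ≫ homotopySquare J m' q' hq' = homotopySquare J m q hq ≫ β := by
  have hβ := Arrow.w β
  rw [hl, hr] at hβ
  simp only [Arrow.mk_hom] at hβ
  apply Arrow.hom_ext
  · rw [Arrow.comp_left, Arrow.comp_left, hl]
    apply pushout.hom_ext
    · rw [reassoc_of% (J.inl_boundaryProductMap α), inl_homotopySquare,
        reassoc_of% (inl_homotopySquare (J := J) hq)]
      apply whiskerRight_twoDesc_comp
      · rw [reassoc_of% hβ, Arrow.w, Category.assoc]
      · simp
    · rw [reassoc_of% (J.inr_boundaryProductMap α), inr_homotopySquare,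
        reassoc_of% (inr_homotopySquare (J := J) hq),
        reassoc_of% (whiskerRight_fst (Z := J.I) α.left), Arrow.w]
  · rw [Arrow.comp_right, Arrow.comp_right, boundaryProductMap_right, hr, homotopySquare_right,
      homotopySquare_right, reassoc_of% (whiskerRight_fst (Z := J.I) α.right), hβ, Category.assoc]

section Homotopy

variable {m : Arrow C} (S : M.cof.Coalg m) {q : m.right ⟶ m.left}
    (hq : m.hom ≫ q = 𝟙 m.left) (T : M.cof.Alg (Arrow.mk q))

/-- The homotopy from `q ≫ m` to the identity. -/
def homotopy : m.right ⊗ J.I ⟶ m.right :=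
  lift (hM.boundaryCoalg S) T (homotopySquare J m q hq)

theorem boundary_homotopy : m.right ◁ J.boundary ≫ homotopy hM S hq T =
    twoDesc (prod.lift (q ≫ m.hom) (𝟙 m.right)) := by
  have h : J.boundaryProduct m ≫ homotopy hM S hq T = (homotopySquare J m q hq).left :=
    hom_lift (hM.boundaryCoalg S) T (homotopySquare J m q hq)
  rw [← inl_boundaryProduct, Category.assoc, h, inl_homotopySquare]

theorem homotopy_zero :
    m.right ◁ J.δ₀ ≫ homotopy hM S hq T = (ρ_ m.right).hom ≫ q ≫ m.hom := by
  rw [← inl_boundary, MonoidalCategory.whiskerLeft_comp, Category.assoc, boundary_homotopy,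
    inl_twoDesc, prod.lift_fst]

theorem homotopy_one : m.right ◁ J.δ₁ ≫ homotopy hM S hq T = (ρ_ m.right).hom := by
  rw [← inr_boundary, MonoidalCategory.whiskerLeft_comp, Category.assoc, boundary_homotopy,
    inr_twoDesc, prod.lift_snd, Category.comp_id]

theorem hom_homotopy : m.hom ▷ J.I ≫ homotopy hM S hq T =
    SemiCartesianMonoidalCategory.fst m.left J.I ≫ m.hom := by
  have h : J.boundaryProduct m ≫ homotopy hM S hq T = (homotopySquare J m q hq).left :=
    hom_lift (hM.boundaryCoalg S) T (homotopySquare J m q hq)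
  rw [← inr_boundaryProduct, Category.assoc, h, inr_homotopySquare]

variable {S hq T}

theorem homotopy_natural {m' : Arrow C} {S' : M.cof.Coalg m'} {q' : m'.right ⟶ m'.left}
    {hq' : m'.hom ≫ q' = 𝟙 m'.left} {T' : M.cof.Alg (Arrow.mk q')}
    {α : m ⟶ m'} {β : Arrow.mk q ⟶ Arrow.mk q'}
    (hα : S.IsHom S' α) (hβ : T.IsHom T' β) (hl : β.left = α.right) (hr : β.right = α.left) :
    α.right ▷ J.I ≫ homotopy hM S' hq' T' = homotopy hM S hq T ≫ α.right := by
  have h := lift_natural (hM.isHom_boundaryCoalg hα) hβ (homotopySquare J m q hq)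
    (homotopySquare J m' q' hq') (homotopySquare_natural hq hq' α β hl hr)
  rw [hl] at h
  exact h

variable (S hq T)

/-- The square from `m` to the pullback hom of `δ₀` and `g` whose fillers yield fillers of the
square `φ` from `m` to `g`. -/
def transportSquare {g : Arrow C} (φ : m ⟶ g) : m ⟶ Arrow.mk (J.endpointHom J.δ₀ g) :=
  Arrow.homMk (φ.left ≫ J.const g.left)
    ((endpointPullback.isPullback g).lift (q ≫ φ.left)
      (J.adj.homEquiv m.right g.right (homotopy hM S hq T ≫ φ.right))
      (by
        rw [J.homEquiv_ev, reassoc_of% (homotopy_zero hM S hq T), Iso.inv_hom_id_assoc,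
          Category.assoc, Arrow.w]))
    (by
      simp only [Arrow.mk_hom]
      apply (endpointPullback.isPullback g).hom_ext
      · rw [Category.assoc, Category.assoc, Category.assoc, endpointHom_fst, J.const_ev,
          IsPullback.lift_fst, reassoc_of% hq, Category.comp_id]
      · rw [Category.assoc, Category.assoc, Category.assoc, endpointHom_snd,
          ← J.const_natural, IsPullback.lift_snd, ← J.adj.homEquiv_naturality_left]
        have h : m.hom ▷ J.I ≫ homotopy hM S hq T ≫ φ.right =
            SemiCartesianMonoidalCategory.fst m.left J.I ≫ φ.left ≫ g.hom := by
          rw [reassoc_of% (hom_homotopy hM S hq T), Arrow.w]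
        rw [← Category.assoc, comp_const]
        exact congrArg _ h.symm)

theorem transportSquare_left {g : Arrow C} (φ : m ⟶ g) :
    (transportSquare hM S hq T φ).left = φ.left ≫ J.const g.left := rfl

theorem transportSquare_fst {g : Arrow C} (φ : m ⟶ g) :
    (transportSquare hM S hq T φ).right ≫ endpointPullback.fst g = q ≫ φ.left :=
  IsPullback.lift_fst _ _ _ _

theorem transportSquare_snd {g : Arrow C} (φ : m ⟶ g) :
    (transportSquare hM S hq T φ).right ≫ endpointPullback.snd g =
      J.adj.homEquiv m.right g.right (homotopy hM S hq T ≫ φ.right) :=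
  IsPullback.lift_snd _ _ _ _

variable {S hq T} in
theorem transportSquare_natural {m' : Arrow C} {S' : M.cof.Coalg m'} {q' : m'.right ⟶ m'.left}
    {hq' : m'.hom ≫ q' = 𝟙 m'.left} {T' : M.cof.Alg (Arrow.mk q')}
    {α : m ⟶ m'} {β : Arrow.mk q ⟶ Arrow.mk q'}
    (hα : S.IsHom S' α) (hβ : T.IsHom T' β) (hl : β.left = α.right) (hr : β.right = α.left)
    {g g' : Arrow C} {γ : g ⟶ g'} {φ : m ⟶ g} {φ' : m' ⟶ g'} (h : α ≫ φ' = φ ≫ γ) :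
    α ≫ transportSquare hM S' hq' T' φ' =
      transportSquare hM S hq T φ ≫ J.endpointHomMap J.δ₀ γ := by
  have h₁ := congrArg (fun s => s.left) h
  have h₂ := congrArg (fun s => s.right) h
  have h₃ := Arrow.w β
  rw [hl, hr] at h₃
  simp only [Arrow.mk_hom, Arrow.comp_left, Arrow.comp_right] at h₁ h₂ h₃
  apply Arrow.hom_ext
  · rw [Arrow.comp_left, Arrow.comp_left, transportSquare_left, transportSquare_left,
      endpointHomMap_left, reassoc_of% h₁, J.const_natural, Category.assoc]
  · rw [Arrow.comp_right, Arrow.comp_right]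
    apply (endpointPullback.isPullback g').hom_ext
    · rw [Category.assoc, Category.assoc, transportSquare_fst, endpointHomMap_fst,
        reassoc_of% (transportSquare_fst hM S hq T φ), reassoc_of% h₃, h₁]
    · rw [Category.assoc, Category.assoc, transportSquare_snd, endpointHomMap_snd,
        reassoc_of% (transportSquare_snd hM S hq T φ), ← J.adj.homEquiv_naturality_left,
        ← J.adj.homEquiv_naturality_right]
      congr 1
      have h₄ := homotopy_natural hM (hq := hq) (hq' := hq') hα hβ hl hr
      rw [Category.assoc, ← h₂, ← reassoc_of% h₄]
      rfl

/-- The filler of a square from a `(C, Fᵗ)`-coalgebra with a retraction which is an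
`Fᵗ`-algebra to an `F`-algebra. -/
def retractLift {g : Arrow C} {U : M.trivCof.Alg g} (hU : M.trivCof.mul.IsAssoc U) (φ : m ⟶ g) :
    m.right ⟶ g.left :=
  lift S (hM.endpointAlg hU) (transportSquare hM S hq T φ) ≫ J.ev J.δ₁ g.left

theorem hom_retractLift {g : Arrow C} {U : M.trivCof.Alg g} (hU : M.trivCof.mul.IsAssoc U)
    (φ : m ⟶ g) : m.hom ≫ retractLift hM S hq T hU φ = φ.left := by
  have h := hom_lift S (hM.endpointAlg hU) (transportSquare hM S hq T φ)
  rw [transportSquare_left] at h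
  rw [retractLift, reassoc_of% h, J.const_ev, Category.comp_id]

theorem retractLift_hom {g : Arrow C} {U : M.trivCof.Alg g} (hU : M.trivCof.mul.IsAssoc U)
    (φ : m ⟶ g) : retractLift hM S hq T hU φ ≫ g.hom = φ.right := by
  have h : lift S (hM.endpointAlg hU) (transportSquare hM S hq T φ) ≫ J.endpointHom J.δ₀ g = _ :=
    lift_hom S (hM.endpointAlg hU) (transportSquare hM S hq T φ)
  rw [retractLift, Category.assoc, ← J.ev_natural, ← J.endpointHom_snd J.δ₀, Category.assoc,
    reassoc_of% h, reassoc_of% (transportSquare_snd hM S hq T φ), J.homEquiv_ev,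
    reassoc_of% (homotopy_one hM S hq T), Iso.inv_hom_id_assoc]

variable {S hq T} in
theorem retractLift_natural {m' : Arrow C} {S' : M.cof.Coalg m'} {q' : m'.right ⟶ m'.left}
    {hq' : m'.hom ≫ q' = 𝟙 m'.left} {T' : M.cof.Alg (Arrow.mk q')}
    {α : m ⟶ m'} {β : Arrow.mk q ⟶ Arrow.mk q'}
    (hα : S.IsHom S' α) (hβ : T.IsHom T' β) (hl : β.left = α.right) (hr : β.right = α.left)
    {g g' : Arrow C} {U : M.trivCof.Alg g} {U' : M.trivCof.Alg g'}
    (hU : M.trivCof.mul.IsAssoc U) (hU' : M.trivCof.mul.IsAssoc U') {γ : g ⟶ g'}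
    (hγ : U.IsHom U' γ) {φ : m ⟶ g} {φ' : m' ⟶ g'} (h : α ≫ φ' = φ ≫ γ) :
    α.right ≫ retractLift hM S' hq' T' hU' φ' = retractLift hM S hq T hU φ ≫ γ.left := by
  have h' := lift_natural hα (hM.isHom_endpointAlg hU hU' hγ) _ _
    (transportSquare_natural hM (hq := hq) (hq' := hq') hα hβ hl hr h)
  rw [endpointHomMap_left] at h'
  rw [retractLift, retractLift, reassoc_of% h', J.ev_natural, Category.assoc]

/-- The structure of a coalgebra for `Cᵗ` on a coalgebra for `C` which has a retraction which is
an algebra for `Fᵗ`. -/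
def retractCoalg : M.trivCof.Coalg m where
  k := retractLift hM S hq T (M.trivCof.mul.isAssoc_alg m) (M.trivCof.unit.app m)
  hom_k := hom_retractLift hM S hq T _ _
  k_R := retractLift_hom hM S hq T _ _

variable {S hq T} in
theorem isHom_retractCoalg {m' : Arrow C} {S' : M.cof.Coalg m'} {q' : m'.right ⟶ m'.left}
    {hq' : m'.hom ≫ q' = 𝟙 m'.left} {T' : M.cof.Alg (Arrow.mk q')}
    {α : m ⟶ m'} {β : Arrow.mk q ⟶ Arrow.mk q'}
    (hα : S.IsHom S' α) (hβ : T.IsHom T' β) (hl : β.left = α.right) (hr : β.right = α.left) :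
    (retractCoalg hM S hq T).IsHom (retractCoalg hM S' hq' T') α :=
  retractLift_natural hM hα hβ hl hr _ _ (M.trivCof.mul.alg_isHom α)
    (M.trivCof.unit.naturality α)

end Homotopy

end Retract

end
end AlgFact

namespace AlgFact

noncomputable section

open FunctorialFactorisation

section

variable {C : Type u} [Category.{v} C] {B : Type w} [Category.{z} B]

/-- The functorial coalgebra structure given by unbundled coalgebra structures. -/
def FunctorialCoalgebraStructure.ofCoalg {Φ : FunctorialFactorisation C} {G : B ⥤ Arrow C}
    (S : ∀ x, Φ.Coalg (G.obj x)) (hS : ∀ {x y : B} (φ : x ⟶ y), (S x).IsHom (S y) (G.map φ)) :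
    FunctorialCoalgebraStructure Φ.counit G where
  coact x := (S x).coalgebra.a
  counit x := (S x).coalgebra.counit
  natural φ := (hS φ).coalgebraHom.comm

/-- The functorial algebra structure given by unbundled algebra structures. -/
def FunctorialAlgebraStructure.ofAlg {Φ : FunctorialFactorisation C} {m : Φ.Multiplication}
    {G : B ⥤ Arrow C} (S : ∀ x, Φ.Alg (G.obj x)) (hS : ∀ x, m.IsAssoc (S x))
    (hS' : ∀ {x y : B} (φ : x ⟶ y), (S x).IsHom (S y) (G.map φ)) :
    FunctorialAlgebraStructure m.monad G where
  act x := (hS x).algebra.a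
  unit x := (hS x).algebra.unit
  assoc x := (hS x).algebra.assoc
  natural {x y} φ := ((hS' φ).algebraHom (hS x) (hS y)).h

/-! ### Algebraically free awfs -/

namespace LAWFS.Hom.IsAlgebraicallyFree

variable {Φ : LAWFS C} {Ψ : AWFS C} {ζ : Φ.Hom Ψ.toLAWFS} (hζ : ζ.IsAlgebraicallyFree)
  (μ : Φ.toFunctorialFactorisation.Multiplication)

/-- The algebra structure on the right part of the factorisation of `f` which corresponds to the
multiplication `μ`. -/
def rightAlg (f : Arrow C) : Ψ.Alg (Arrow.mk (Φ.R f)) :=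
  (ζ.toHom.exists_alg hζ (μ.alg f)).choose

theorem isAssoc_rightAlg (f : Arrow C) : Ψ.mul.IsAssoc (hζ.rightAlg μ f) :=
  (ζ.toHom.exists_alg hζ (μ.alg f)).choose_spec.1

theorem alg_rightAlg (f : Arrow C) : ζ.toHom.alg (hζ.rightAlg μ f) = μ.alg f :=
  (ζ.toHom.exists_alg hζ (μ.alg f)).choose_spec.2

theorem isHom_rightAlg {f g : Arrow C} (φ : f ⟶ g) :
    (hζ.rightAlg μ f).IsHom (hζ.rightAlg μ g) (Φ.right.map φ) := by
  apply Alg.IsHom.of_map hζ (hζ.isAssoc_rightAlg μ f) (hζ.isAssoc_rightAlg μ g)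
  rw [alg_rightAlg, alg_rightAlg]
  exact μ.alg_isHom φ

end LAWFS.Hom.IsAlgebraicallyFree

theorem fibreSquare_isPullback [HasPullbacks C] [HasBinaryProducts C] (f : Arrow C) :
    IsPullback (prod.lift (pullback.fst f.hom f.hom) (pullback.snd f.hom f.hom))
      (pullback.fst f.hom f.hom ≫ f.hom) (prod.map f.hom f.hom)
      (prod.lift (𝟙 f.right) (𝟙 f.right)) := by
  have h₁ (s : PullbackCone (prod.map f.hom f.hom) (prod.lift (𝟙 f.right) (𝟙 f.right))) :
      (s.fst ≫ prod.fst) ≫ f.hom = s.snd := by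
    simpa [prod.lift_fst] using congrArg (fun t => t ≫ prod.fst) s.condition
  have h₂ (s : PullbackCone (prod.map f.hom f.hom) (prod.lift (𝟙 f.right) (𝟙 f.right))) :
      (s.fst ≫ prod.snd) ≫ f.hom = s.snd := by
    simpa [prod.lift_snd] using congrArg (fun t => t ≫ prod.snd) s.condition
  refine IsPullback.of_isLimit' ⟨?_⟩ (PullbackCone.IsLimit.mk _
    (fun s => pullback.lift (s.fst ≫ prod.fst) (s.fst ≫ prod.snd) ((h₁ s).trans (h₂ s).symm))
    (fun s => ?_) (fun s => ?_) (fun s t ht _ => ?_))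
  · apply Limits.prod.hom_ext
    · simp [prod.lift_fst]
    · simp [prod.lift_snd, pullback.condition]
  · apply Limits.prod.hom_ext
    · simp [prod.lift_fst, pullback.lift_fst]
    · simp [prod.lift_snd, pullback.lift_snd]
  · rw [pullback.lift_fst_assoc, h₁]
  · apply pullback.hom_ext
    · rw [pullback.lift_fst, ← ht, Category.assoc, prod.lift_fst]
    · rw [pullback.lift_snd, ← ht, Category.assoc, prod.lift_snd]

end

variable {C : Type u} [Category.{v} C] [SemiCartesianMonoidalCategory C]

namespace Interval

/-! ### The projections of the mapping path space as pullbacks -/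

section Proj

variable [HasPullbacks C] (J : Interval C) (d : 𝟙_ C ⟶ J.I)

/-- The map sending a point to itself and to the constant path at its image. -/
def toEndpointPullback (f : Arrow C) : f.left ⟶ J.endpointPullback d f :=
  (endpointPullback.isPullback f).lift (𝟙 f.left) (f.hom ≫ J.const f.right)
    (by rw [Category.assoc, J.const_ev, Category.comp_id, Category.id_comp])

theorem toEndpointPullback_fst (f : Arrow C) :
    J.toEndpointPullback d f ≫ endpointPullback.fst f = 𝟙 f.left :=
  IsPullback.lift_fst _ _ _ _

theorem toEndpointPullback_snd (f : Arrow C) :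
    J.toEndpointPullback d f ≫ endpointPullback.snd f = f.hom ≫ J.const f.right :=
  IsPullback.lift_snd _ _ _ _

theorem proj_toEndpointPullback (f : Arrow C) :
    pullback.snd (J.const f.right) (J.P.map f.hom) ≫ J.endpointHom d f =
      J.proj d f ≫ J.toEndpointPullback d f := by
  apply (endpointPullback.isPullback f).hom_ext
  · rw [Category.assoc, Category.assoc, endpointHom_fst, toEndpointPullback_fst,
      Category.comp_id, proj]
  · rw [Category.assoc, Category.assoc, endpointHom_snd, toEndpointPullback_snd,
      reassoc_of% (J.proj_over d f), pullback.condition]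

theorem isPullback_proj (f : Arrow C) :
    IsPullback (pullback.snd (J.const f.right) (J.P.map f.hom)) (J.proj d f) (J.endpointHom d f)
      (J.toEndpointPullback d f) := by
  have h : IsPullback (J.toEndpointPullback d f ≫ endpointPullback.fst f) f.hom f.hom
      (J.const f.right ≫ J.ev d f.right) := by
    rw [toEndpointPullback_fst, J.const_ev]
    exact IsPullback.of_horiz_isIso ⟨by simp⟩
  have h' := h.of_right (J.toEndpointPullback_snd d f) (endpointPullback.isPullback f)
  refine IsPullback.of_bot ?_ (J.proj_toEndpointPullback d f) h'
  rw [proj_over, endpointHom_snd]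
  exact (IsPullback.of_hasPullback (J.const f.right) (J.P.map f.hom)).flip

/-- The square exhibiting the projection of the mapping path space at `d` as a pullback of the
pullback hom from `d`. -/
def projSquare (f : Arrow C) : Arrow.mk (J.proj d f) ⟶ Arrow.mk (J.endpointHom d f) :=
  Arrow.homMk (pullback.snd (J.const f.right) (J.P.map f.hom)) (J.toEndpointPullback d f)
    (J.proj_toEndpointPullback d f)

/-- The functoriality of the projections of the mapping path space. -/
def projMap {f g : Arrow C} (φ : f ⟶ g) : Arrow.mk (J.proj d f) ⟶ Arrow.mk (J.proj d g) :=
  Arrow.homMk (J.mappingPath.map φ) φ.left (J.proj_natural d φ)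

theorem projSquare_natural {f g : Arrow C} (φ : f ⟶ g) :
    J.projMap d φ ≫ J.projSquare d g = J.projSquare d f ≫ J.endpointHomMap d φ := by
  apply Arrow.hom_ext
  · exact pullback.lift_snd _ _ _
  · have e : φ.left ≫ J.toEndpointPullback d g =
        J.toEndpointPullback d f ≫ (J.endpointHomMap d φ).right := by
      apply (endpointPullback.isPullback g).hom_ext
      · rw [Category.assoc, Category.assoc, endpointHomMap_fst, toEndpointPullback_fst,
          reassoc_of% (J.toEndpointPullback_fst d f), Category.comp_id]
      · rw [Category.assoc, Category.assoc, endpointHomMap_snd, toEndpointPullback_snd,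
          reassoc_of% (J.toEndpointPullback_snd d f), ← J.const_natural, Arrow.w_assoc]
    exact e

theorem endpoints_fst (f : Arrow C) : J.endpoints f ≫ pullback.fst f.hom f.hom = J.proj J.δ₀ f :=
  pullback.lift_fst _ _ _

theorem endpoints_snd (f : Arrow C) : J.endpoints f ≫ pullback.snd f.hom f.hom = J.proj J.δ₁ f :=
  pullback.lift_snd _ _ _

/-- The functoriality of the composite `Id_Y(X) ⟶ P_Y(X) ⟶ X`. -/
def idProjMap (Φ : FunctorialFactorisation C) {f g : Arrow C} (φ : f ⟶ g) :
    Arrow.mk (Φ.R (J.reflFunctor.obj f) ≫ J.proj J.δ₀ f) ⟶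
      Arrow.mk (Φ.R (J.reflFunctor.obj g) ≫ J.proj J.δ₀ g) :=
  Arrow.homMk (Φ.K.map (J.reflFunctor.map φ)) φ.left (by
    have h₁ := R_natural_assoc (Φ := Φ) (J.reflFunctor.map φ) (J.proj J.δ₀ g)
    have h₂ := congrArg (fun s => Φ.R (J.reflFunctor.obj f) ≫ s) (J.proj_natural J.δ₀ φ)
    exact h₁.trans (h₂.trans (Category.assoc _ _ _).symm))

theorem L_idProj (Φ : FunctorialFactorisation C) (f : Arrow C) :
    Φ.L (J.reflFunctor.obj f) ≫ Φ.R (J.reflFunctor.obj f) ≫ J.proj J.δ₀ f = 𝟙 f.left := by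
  have h := reassoc_of% (Φ.fac (J.reflFunctor.obj f))
  exact (h _).trans (J.refl_proj J.δ₀ f)

end Proj

section Endpoints

variable [HasFiniteLimits C] [HasFiniteColimits C]
  [∀ X : C, PreservesFiniteColimits (tensorLeft X)] (J : Interval C)

/-- The map sending a pair of points in the same fibre to itself and to the constant path at
its image. -/
def toBoundaryPullback (f : Arrow C) : fibreSquare.obj f ⟶ J.boundaryPullback f :=
  (boundaryPullback.isPullback f).lift
    (prod.lift (pullback.fst f.hom f.hom) (pullback.snd f.hom f.hom))
    ((pullback.fst f.hom f.hom ≫ f.hom) ≫ J.const f.right)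
    (by
      apply Limits.prod.hom_ext
      · simp only [Category.assoc, prod.map_fst, prod.lift_fst, prod.lift_fst_assoc, J.const_ev,
          Category.comp_id]
      · simp only [Category.assoc, prod.map_snd, prod.lift_snd, prod.lift_snd_assoc, J.const_ev,
          Category.comp_id, pullback.condition])

theorem toBoundaryPullback_fst (f : Arrow C) :
    J.toBoundaryPullback f ≫ boundaryPullback.fst f =
      prod.lift (pullback.fst f.hom f.hom) (pullback.snd f.hom f.hom) :=
  IsPullback.lift_fst _ _ _ _

theorem toBoundaryPullback_snd (f : Arrow C) :
    J.toBoundaryPullback f ≫ boundaryPullback.snd f =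
      (pullback.fst f.hom f.hom ≫ f.hom) ≫ J.const f.right :=
  IsPullback.lift_snd _ _ _ _

theorem endpoints_toBoundaryPullback (f : Arrow C) :
    pullback.snd (J.const f.right) (J.P.map f.hom) ≫ J.boundaryHom f =
      J.endpoints f ≫ J.toBoundaryPullback f := by
  apply (boundaryPullback.isPullback f).hom_ext
  · rw [Category.assoc, Category.assoc, boundaryHom_fst, toBoundaryPullback_fst]
    apply Limits.prod.hom_ext
    · rw [Category.assoc, Category.assoc, prod.lift_fst, prod.lift_fst]
      exact (J.endpoints_fst f).symm
    · rw [Category.assoc, Category.assoc, prod.lift_snd, prod.lift_snd]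
      exact (J.endpoints_snd f).symm
  · rw [Category.assoc, Category.assoc, boundaryHom_snd, toBoundaryPullback_snd,
      ← Category.assoc (J.endpoints f), ← Category.assoc (J.endpoints f), endpoints_fst,
      J.proj_over, pullback.condition]

theorem isPullback_endpoints (f : Arrow C) :
    IsPullback (pullback.snd (J.const f.right) (J.P.map f.hom)) (J.endpoints f) (J.boundaryHom f)
      (J.toBoundaryPullback f) := by
  have h : IsPullback (J.toBoundaryPullback f ≫ boundaryPullback.fst f)
      (pullback.fst f.hom f.hom ≫ f.hom) (prod.map f.hom f.hom)
      (J.const f.right ≫ prod.lift (J.ev J.δ₀ f.right) (J.ev J.δ₁ f.right)) := by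
    rw [toBoundaryPullback_fst, prod.comp_lift, J.const_ev, J.const_ev]
    exact fibreSquare_isPullback f
  have h' := h.of_right (J.toBoundaryPullback_snd f) (boundaryPullback.isPullback f)
  refine IsPullback.of_bot ?_ (J.endpoints_toBoundaryPullback f) h'
  rw [← Category.assoc, endpoints_fst, proj_over, boundaryHom_snd]
  exact (IsPullback.of_hasPullback (J.const f.right) (J.P.map f.hom)).flip

/-- The square exhibiting the endpoints of the mapping path space as a pullback of the
pullback hom from the boundary of the interval. -/
def endpointsSquare (f : Arrow C) : Arrow.mk (J.endpoints f) ⟶ Arrow.mk (J.boundaryHom f) :=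
  Arrow.homMk (pullback.snd (J.const f.right) (J.P.map f.hom)) (J.toBoundaryPullback f)
    (J.endpoints_toBoundaryPullback f)

/-- The functoriality of the endpoints of the mapping path space. -/
def endpointsMap {f g : Arrow C} (φ : f ⟶ g) :
    Arrow.mk (J.endpoints f) ⟶ Arrow.mk (J.endpoints g) :=
  Arrow.homMk (J.mappingPath.map φ) (fibreSquare.map φ) (J.endpoints_natural φ)

theorem endpointsSquare_natural {f g : Arrow C} (φ : f ⟶ g) :
    J.endpointsMap φ ≫ J.endpointsSquare g = J.endpointsSquare f ≫ J.boundaryHomMap φ := by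
  apply Arrow.hom_ext
  · exact pullback.lift_snd _ _ _
  · have e : fibreSquare.map φ ≫ J.toBoundaryPullback g =
        J.toBoundaryPullback f ≫ (J.boundaryHomMap φ).right := by
      apply (boundaryPullback.isPullback g).hom_ext
      · rw [Category.assoc, Category.assoc, boundaryHomMap_fst, toBoundaryPullback_fst,
          reassoc_of% (J.toBoundaryPullback_fst f)]
        apply Limits.prod.hom_ext
        · rw [Category.assoc, Category.assoc, prod.lift_fst, prod.map_fst, prod.lift_fst_assoc]
          exact pullback.lift_fst _ _ _
        · rw [Category.assoc, Category.assoc, prod.lift_snd, prod.map_snd, prod.lift_snd_assoc]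
          exact pullback.lift_snd _ _ _
      · rw [Category.assoc, Category.assoc, boundaryHomMap_snd, toBoundaryPullback_snd,
          reassoc_of% (J.toBoundaryPullback_snd f), ← J.const_natural]
        have h : fibreSquare.map φ ≫ pullback.fst g.hom g.hom =
            pullback.fst f.hom f.hom ≫ φ.left := pullback.lift_fst _ _ _
        rw [← Category.assoc, ← Category.assoc, h]
        simp only [Category.assoc, Arrow.w_assoc]
    exact e

end Endpoints

end Interval

end

end AlgFact

namespace AlgFact

noncomputable section

open FunctorialFactorisation

variable {C : Type u} [Category.{v} C] [SemiCartesianMonoidalCategory C]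
  [HasFiniteLimits C] [HasFiniteColimits C] [∀ X : C, PreservesFiniteColimits (tensorLeft X)]
  {M : PreAMS C} {J : Interval C} (hM : Conditions M J)

/-! ### Very good path objects -/

namespace Conditions

/-- The `Fᵗ`-algebra structure on the first projection of the mapping path space of an
`F`-algebra. -/
def projAlg {f : Arrow C} {T : M.trivCof.Alg f} (hT : M.trivCof.mul.IsAssoc T) :
    M.cof.Alg (Arrow.mk (J.proj J.δ₀ f)) :=
  (hM.endpointAlg hT).pullback (J.projSquare J.δ₀ f) (J.isPullback_proj J.δ₀ f)

theorem isHom_projAlg {f g : Arrow C} {T : M.trivCof.Alg f} {T' : M.trivCof.Alg g}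
    (hT : M.trivCof.mul.IsAssoc T) (hT' : M.trivCof.mul.IsAssoc T') {φ : f ⟶ g}
    (h : T.IsHom T' φ) :
    (hM.projAlg hT).IsHom (hM.projAlg hT') (J.projMap J.δ₀ φ) :=
  (hM.isHom_endpointAlg hT hT' h).pullback (J.projSquare_natural J.δ₀ φ)

/-- The `F`-algebra structure on the endpoints of the mapping path space of an `F`-algebra. -/
def endpointsAlg {f : Arrow C} {T : M.trivCof.Alg f} (hT : M.trivCof.mul.IsAssoc T) :
    M.trivCof.Alg (Arrow.mk (J.endpoints f)) :=
  (hM.boundaryAlg hT).pullback (J.endpointsSquare f) (J.isPullback_endpoints f)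

theorem isAssoc_endpointsAlg {f : Arrow C} {T : M.trivCof.Alg f}
    (hT : M.trivCof.mul.IsAssoc T) : M.trivCof.mul.IsAssoc (hM.endpointsAlg hT) :=
  (hM.isAssoc_boundaryAlg hT).pullback _ _

theorem isHom_endpointsAlg {f g : Arrow C} {T : M.trivCof.Alg f} {T' : M.trivCof.Alg g}
    (hT : M.trivCof.mul.IsAssoc T) (hT' : M.trivCof.mul.IsAssoc T') {φ : f ⟶ g}
    (h : T.IsHom T' φ) :
    (hM.endpointsAlg hT).IsHom (hM.endpointsAlg hT') (J.endpointsMap φ) :=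
  (hM.isHom_boundaryAlg hT hT' h).pullback (J.endpointsSquare_natural φ)

variable {Φ : LAWFS C} {ζ : Φ.Hom M.cof.toLAWFS} (hζ : ζ.IsAlgebraicallyFree)
  (μ : Φ.toFunctorialFactorisation.Multiplication)

/-- The `Fᵗ`-algebra structure on the composite `Id_Y(X) ⟶ P_Y(X) ⟶ X`. -/
def idProjAlg {f : Arrow C} {T : M.trivCof.Alg f} (hT : M.trivCof.mul.IsAssoc T) :
    M.cof.Alg (Arrow.mk (Φ.R (J.reflFunctor.obj f) ≫ J.proj J.δ₀ f)) :=
  (hζ.rightAlg μ (J.reflFunctor.obj f)).comp M.cof.comul (hM.projAlg hT)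

/-- The `F`-algebra structure on the composite `Id_Y(X) ⟶ P_Y(X) ⟶ X ×_Y X`. -/
def idEndpointsAlg {f : Arrow C} {T : M.trivCof.Alg f} (hT : M.trivCof.mul.IsAssoc T) :
    M.trivCof.Alg (Arrow.mk (Φ.R (J.reflFunctor.obj f) ≫ J.endpoints f)) :=
  (M.comparison.toHom.alg (hζ.rightAlg μ (J.reflFunctor.obj f))).comp M.trivCof.comul
    (hM.endpointsAlg hT)

theorem isAssoc_idEndpointsAlg {f : Arrow C} {T : M.trivCof.Alg f}
    (hT : M.trivCof.mul.IsAssoc T) : M.trivCof.mul.IsAssoc (hM.idEndpointsAlg hζ μ hT) :=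
  (M.comparison.isAssoc_alg (hζ.isAssoc_rightAlg μ (J.reflFunctor.obj f))).comp
    M.trivCof.distributive (hM.isAssoc_endpointsAlg hT)

theorem isHom_idEndpointsAlg {f g : Arrow C} {T : M.trivCof.Alg f} {T' : M.trivCof.Alg g}
    (hT : M.trivCof.mul.IsAssoc T) (hT' : M.trivCof.mul.IsAssoc T') {φ : f ⟶ g}
    (h : T.IsHom T' φ)
    (ψ : Arrow.mk (Φ.R (J.reflFunctor.obj f) ≫ J.endpoints f) ⟶
      Arrow.mk (Φ.R (J.reflFunctor.obj g) ≫ J.endpoints g))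
    (hl : ψ.left = Φ.K.map (J.reflFunctor.map φ)) (hr : ψ.right = fibreSquare.map φ) :
    (hM.idEndpointsAlg hζ μ hT).IsHom (hM.idEndpointsAlg hζ μ hT') ψ :=
  ((hζ.isHom_rightAlg μ (J.reflFunctor.map φ)).map M.comparison.toHom).comp_isHom _
    (hM.isHom_endpointsAlg hT hT' h) rfl ψ hl hr

theorem isHom_idProjAlg {f g : Arrow C} {T : M.trivCof.Alg f} {T' : M.trivCof.Alg g}
    (hT : M.trivCof.mul.IsAssoc T) (hT' : M.trivCof.mul.IsAssoc T') {φ : f ⟶ g}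
    (h : T.IsHom T' φ) :
    (hM.idProjAlg hζ μ hT).IsHom (hM.idProjAlg hζ μ hT')
      (J.idProjMap Φ.toFunctorialFactorisation φ) :=
  (hζ.isHom_rightAlg μ (J.reflFunctor.map φ)).comp_isHom _ (hM.isHom_projAlg hT hT' h) rfl _
    rfl rfl

/-- The `Cᵗ`-coalgebra structure on `X ⟶ Id_Y(X)`. -/
def idCoalg {f : Arrow C} {T : M.trivCof.Alg f} (hT : M.trivCof.mul.IsAssoc T) :
    M.trivCof.Coalg (Arrow.mk (Φ.L (J.reflFunctor.obj f))) :=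
  retractCoalg hM (ζ.toHom.coalg (Φ.comul.coalg (J.reflFunctor.obj f)))
    (J.L_idProj Φ.toFunctorialFactorisation f) (hM.idProjAlg hζ μ hT)

theorem isHom_idCoalg {f g : Arrow C} {T : M.trivCof.Alg f} {T' : M.trivCof.Alg g}
    (hT : M.trivCof.mul.IsAssoc T) (hT' : M.trivCof.mul.IsAssoc T') {φ : f ⟶ g}
    (h : T.IsHom T' φ) :
    (hM.idCoalg hζ μ hT).IsHom (hM.idCoalg hζ μ hT') (Φ.left.map (J.reflFunctor.map φ)) :=
  isHom_retractCoalg hM ((Φ.comul.coalg_isHom (J.reflFunctor.map φ)).map ζ.toHom)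
    (hM.isHom_idProjAlg hζ μ hT hT' h) rfl rfl

/-- The factorisation of the diagonal through `Id_Y(X)` as a functorial choice of very good path
objects. -/
def veryGoodPathObjects : FunctorialVeryGoodPathObjects M.trivCof where
  toDiagonalFactorisation := J.idFactorisation Φ.toFunctorialFactorisation M.trivCof
  rStructure := FunctorialCoalgebraStructure.ofCoalg
    (fun f => hM.idCoalg hζ μ (Multiplication.isAssoc_algOfAlgebra f))
    (fun {f g} φ => hM.isHom_idCoalg hζ μ (Multiplication.isAssoc_algOfAlgebra f)
      (Multiplication.isAssoc_algOfAlgebra g) (Multiplication.isHom_algOfAlgebra φ))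
  pStructure := FunctorialAlgebraStructure.ofAlg
    (fun f => hM.idEndpointsAlg hζ μ (Multiplication.isAssoc_algOfAlgebra f))
    (fun f => hM.isAssoc_idEndpointsAlg hζ μ (Multiplication.isAssoc_algOfAlgebra f))
    (fun {f g} φ => hM.isHom_idEndpointsAlg hζ μ (Multiplication.isAssoc_algOfAlgebra f)
      (Multiplication.isAssoc_algOfAlgebra g) (Multiplication.isHom_algOfAlgebra φ) _ rfl rfl)

end Conditions

end

end AlgFact

theorem mainTheorem3 {C : Type u} [Category.{v} C] [SemiCartesianMonoidalCategory C]
    [SymmetricCategory C] [HasFiniteLimits C] [HasFiniteColimits C]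
    [∀ X : C, PreservesFiniteColimits (tensorLeft X)]
    (M : AlgFact.PreAMS C) (J : AlgFact.Interval C) (hM : AlgFact.Conditions M J)
    (Φ : AlgFact.LAWFS C) (ζ : Φ.Hom M.cof.toLAWFS) (hζ : ζ.IsAlgebraicallyFree)
    (m : Φ.toFunctorialFactorisation.Multiplication) :
    ∃ S : AlgFact.FunctorialVeryGoodPathObjects M.trivCof,
      S.toDiagonalFactorisation =
        J.idFactorisation Φ.toFunctorialFactorisation M.trivCof :=
  ⟨hM.veryGoodPathObjects hζ m, rfl⟩
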